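/- **Proposition 1.2.** Let $n\ge 1$ and let $q,t^{1/2}\in\mathbb{C}^\times$ be such that $q^at^b\neq 1$ for all integers $a\ge 1$ and $0\le b\le n-1$. On $\mathbb{C}[x_1^{\pm1},\dots,x_n^{\pm1}]$ let $S_n$ act by permuting the variables, let $s_1,\dots,s_{n-1}$ be the simple transpositions, and define $$T_i=t^{-\frac12}\Big(t-\frac{tx_i-x_{i+1}}{x_i-x_{i+1}}(1-s_i)\Big)\ (1\le i\le n-1),\qquad g=s_1s_2\cdots s_{n-1}T_{q^{-1},x_n},$$ where $(T_{q^{-1},x_n}h)(x_1,\dots,x_n)=h(x_1,\dots,x_{n-1},q^{-1}x_n)$, and $$Y_1=gT_{n-1}\cdots T_1,\qquad Y_{i+1}=T_i^{-1}Y_iT_i^{-1}\ (1\le i\le n-1).$$ Let $S_n$ act on $\mathbb{Z}^n$ by permuting positions, and let $\ell(z)$ be the number of inversions of $z\in S_n$. For $z\in S_n$ put $T_z=T_{i_1}\cdots T_{i_\ell}$, where $z=s_{i_1}\cdots s_{i_\ell}$ is a reduced word. For $\mu\in\mathbb{Z}^n$ let $v_\mu\in S_n$ be of minimal length such that $v_\mu\mu$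 is weakly increasing, let $\lambda$ be the weakly decreasing rearrangement of $\mu$, and let $z_\mu\in S_n$ be of minimal length such that $\mu=z_\mu\lambda$. Then for each $\mu\in\mathbb{Z}^n$ there is a unique $E_\mu\in\mathbb{C}[x_1^{\pm1},\dots,x_n^{\pm1}]$ (the nonsymmetric Macdonald polynomial) such that $$Y_iE_\mu=q^{-\mu_i}t^{-(v_\mu(i)-1)+\frac12(n-1)}E_\mu\quad(1\le i\le n)$$ and the coefficient of $x_1^{\mu_1}\cdots x_n^{\mu_n}$ in $E_\mu$ is $1$. Moreover, the elements $$f_\mu=t^{\frac12\ell(z_\mu)}T_{z_\mu}E_\lambda\qquad(\mu\in\mathbb{Z}^n)$$ form a KZ-family: for all $\mu\in\mathbb{Z}^n$ and $i\in\{1,\dots,n-1\}$, $$t^{\frac12}T_if_\mu=\begin{cases}f_{s_i\mu},&\text{if }\mu_i>\mu_{i+1},\\ t f_\mu,&\text{if }\mu_i=\mu_{i+1},\end{cases}\qquad\text{and}\qquad gf_\mu=q^{-\mu_n}f_{(\mu_n,\mu_1,\dots,\mu_{n-1})}.$$ -/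

import Mathlib

/-!
Conventions. There are `n = m + 1` variables `x₁, …, xₙ`, indexed by `Fin (m + 1)` (so that `xᵢ` is
the variable with index `i - 1`), and the simple transpositions `s₁, …, sₙ₋₁` are indexed by
`Fin m`. The parameters are `q` and `u = t ^ (1/2)`, both nonzero complex numbers, and `t = u ^ 2`.
-/

noncomputable section

namespace KZ

/-- The Laurent polynomial ring `ℂ[x₁^±¹, …, xₙ^±¹]`, as the group algebra of the lattice `ℤⁿ`
of exponents (`n = m + 1`). -/
abbrev Laurent (m : ℕ) : Type := AddMonoidAlgebra ℂ (Fin (m + 1) → ℤ)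

/-- The monomial `x₁^μ₁ ⋯ xₙ^μₙ`. -/
def mono {m : ℕ} (μ : Fin (m + 1) → ℤ) : Laurent m := AddMonoidAlgebra.single μ 1

/-- The variable with index `j`. -/
def var {m : ℕ} (j : Fin (m + 1)) : Laurent m := mono (Pi.single j 1)

/-! ### The symmetric group -/

/-- The simple transposition `sᵢ`, exchanging two neighbouring indices. -/
def s {m : ℕ} (i : Fin m) : Equiv.Perm (Fin (m + 1)) := Equiv.swap i.castSucc i.succ

/-- The action of permutations on `ℤⁿ` by permuting positions: the entry of `z μ` at position
`z j` is `μ j`. -/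
def act {m : ℕ} (z : Equiv.Perm (Fin (m + 1))) (μ : Fin (m + 1) → ℤ) : Fin (m + 1) → ℤ :=
  fun j => μ (z⁻¹ j)

/-- The set of inversions of a permutation. -/
def inversions {m : ℕ} (z : Equiv.Perm (Fin (m + 1))) : Finset (Fin (m + 1) × Fin (m + 1)) :=
  Finset.univ.filter fun p => p.1 < p.2 ∧ z p.2 < z p.1

theorem mem_inversions {m : ℕ} (z : Equiv.Perm (Fin (m + 1))) (a b : Fin (m + 1)) :
    (a, b) ∈ inversions z ↔ a < b ∧ z b < z a := by
  simp [inversions]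

/-- The length `ℓ(z)` of a permutation: its number of inversions. -/
def length {m : ℕ} (z : Equiv.Perm (Fin (m + 1))) : ℕ := (inversions z).card

/-- The word `s_{i₁} ⋯ s_{iₗ}` is a reduced word of `z`. -/
def IsReducedWord {m : ℕ} (z : Equiv.Perm (Fin (m + 1))) (w : List (Fin m)) : Prop :=
  (w.map s).prod = z ∧ w.length = length z

/-- `z` has minimal length among the permutations satisfying `p`. -/
def IsMinLength {m : ℕ} (p : Equiv.Perm (Fin (m + 1)) → Prop) (z : Equiv.Perm (Fin (m + 1))) :
    Prop :=
  p z ∧ ∀ y, p y → length z ≤ length y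

theorem exists_isMinLength {m : ℕ} {p : Equiv.Perm (Fin (m + 1)) → Prop} (h : ∃ z, p z) :
    ∃ z, IsMinLength p z := by
  classical
  obtain ⟨z₀, h₀⟩ := h
  obtain ⟨z, hz, hmin⟩ := Finset.exists_min_image (Finset.univ.filter p) length ⟨z₀, by simpa⟩
  exact ⟨z, by simpa using hz, fun y hy => hmin y (by simpa)⟩

theorem s_lt {m : ℕ} (i : Fin m) {a b : Fin (m + 1)} (hab : a < b)
    (hne : ¬ (a = i.castSucc ∧ b = i.succ)) : s i a < s i b := by
  unfold s
  simp only [Equiv.swap_apply_def]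
  simp only [Fin.ext_iff, Fin.lt_def, Fin.val_castSucc, Fin.val_succ] at *
  split_ifs <;> simp <;> omega

theorem s_s {m : ℕ} (i : Fin m) (a : Fin (m + 1)) : s i (s i a) = a := by
  simp [s]

theorem length_mul_s {m : ℕ} (z : Equiv.Perm (Fin (m + 1))) (i : Fin m)
    (h : z i.succ < z i.castSucc) : length (z * s i) + 1 = length z := by
  classical
  have hi : i.castSucc < i.succ := Fin.castSucc_lt_succ
  have hs1 : s i i.castSucc = i.succ := by simp [s]
  have hs2 : s i i.succ = i.castSucc := by simp [s]
  have hmem : (i.castSucc, i.succ) ∈ inversions z := by simp [mem_inversions, hi, h]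
  have key : (inversions (z * s i)).card = ((inversions z).erase (i.castSucc, i.succ)).card := by
    refine Finset.card_bij' (fun p _ => (s i p.1, s i p.2)) (fun p _ => (s i p.1, s i p.2))
      ?_ ?_ ?_ ?_
    · rintro ⟨a, b⟩ hp
      simp only [mem_inversions, Equiv.Perm.mul_apply, Finset.mem_erase, ne_eq, Prod.mk.injEq] at hp ⊢
      obtain ⟨hab, hz⟩ := hp
      refine ⟨?_, s_lt i hab ?_, hz⟩
      · rintro ⟨h1, h2⟩
        have h1' : a = i.succ := by rw [← s_s i a, h1, hs1]
        have h2' : b = i.castSucc := by rw [← s_s i b, h2, hs2]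
        subst h1' h2'
        exact absurd hab (not_lt.mpr hi.le)
      · rintro ⟨rfl, rfl⟩
        rw [hs1, hs2] at hz
        exact absurd hz (not_lt.mpr h.le)
    · rintro ⟨a, b⟩ hp
      simp only [mem_inversions, Equiv.Perm.mul_apply, Finset.mem_erase, ne_eq, Prod.mk.injEq] at hp ⊢
      obtain ⟨hne, hab, hz⟩ := hp
      exact ⟨s_lt i hab hne, by simpa only [s_s] using hz⟩
    · rintro ⟨a, b⟩ _
      simp only [s_s]
    · rintro ⟨a, b⟩ _
      simp only [s_s]
  unfold length
  rw [key, Finset.card_erase_add_one hmem]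

theorem exists_isReducedWord {m : ℕ} (z : Equiv.Perm (Fin (m + 1))) :
    ∃ w, IsReducedWord z w := by
  generalize hk : length z = k
  induction k generalizing z with
  | zero =>
    refine ⟨[], ?_, by simp [hk]⟩
    have hmono : Monotone z := by
      intro a b hab
      by_contra hlt
      have hmem : (a, b) ∈ inversions z := by
        rw [mem_inversions]
        refine ⟨lt_of_le_of_ne hab ?_, not_le.mp hlt⟩
        rintro rfl
        exact hlt le_rfl
      rw [length, Finset.card_eq_zero] at hk
      simp [hk] at hmem
    simpa using ((Equiv.Perm.monotone_iff z).mp hmono).symm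
  | succ k ih =>
    have hex : ∃ i : Fin m, z i.succ < z i.castSucc := by
      by_contra hno
      push Not at hno
      have hmono : Monotone z := Fin.monotone_iff_le_succ.mpr hno
      have hz : inversions z = ∅ := by
        ext ⟨a, b⟩
        simp only [mem_inversions, Finset.notMem_empty, iff_false, not_and, not_lt]
        exact fun hab => hmono hab.le
      rw [length, hz] at hk
      simp at hk
    obtain ⟨i, hi⟩ := hex
    have hl := length_mul_s z i hi
    obtain ⟨w, hw, hwl⟩ := ih (z * s i) (by omega)
    refine ⟨w ++ [i], ?_, ?_⟩
    · have hss : s i * s i = 1 := by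
        ext a
        simp [s_s]
      simp [hw, mul_assoc, hss]
    · simp only [List.length_append, List.length_singleton]
      omega

/-- The weakly decreasing rearrangement `λ` of `μ`. -/
def decr {m : ℕ} (μ : Fin (m + 1) → ℤ) : Fin (m + 1) → ℤ :=
  fun j => μ (Tuple.sort μ j.rev)

theorem antitone_decr {m : ℕ} (μ : Fin (m + 1) → ℤ) : Antitone (decr μ) :=
  fun _ _ hab => Tuple.monotone_sort μ (Fin.rev_le_rev.mpr hab)

theorem exists_act_decr {m : ℕ} (μ : Fin (m + 1) → ℤ) :
    ∃ z : Equiv.Perm (Fin (m + 1)), act z (decr μ) = μ := by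
  refine ⟨Fin.revPerm.trans (Tuple.sort μ), ?_⟩
  funext j
  simp [act, decr, Equiv.Perm.inv_def]

theorem exists_act_monotone {m : ℕ} (μ : Fin (m + 1) → ℤ) :
    ∃ v : Equiv.Perm (Fin (m + 1)), Monotone (act v μ) := by
  refine ⟨(Tuple.sort μ)⁻¹, ?_⟩
  have h : act (Tuple.sort μ)⁻¹ μ = μ ∘ Tuple.sort μ := by
    funext j
    simp [act]
  rw [h]
  exact Tuple.monotone_sort μ

/-- `z_μ`: the minimal length permutation such that `μ = z_μ λ`, where `λ` is the weakly
decreasing rearrangement of `μ`. -/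
def zPerm {m : ℕ} (μ : Fin (m + 1) → ℤ) : Equiv.Perm (Fin (m + 1)) :=
  (exists_isMinLength (exists_act_decr μ)).choose

/-- `v_μ`: the minimal length permutation such that `v_μ μ` is weakly increasing. -/
def vPerm {m : ℕ} (μ : Fin (m + 1) → ℤ) : Equiv.Perm (Fin (m + 1)) :=
  (exists_isMinLength (exists_act_monotone μ)).choose

/-! ### Operators on Laurent polynomials -/

/-- The linear operator on Laurent polynomials with prescribed values `F μ` on the monomials. -/
def linOp {m : ℕ} (F : (Fin (m + 1) → ℤ) → Laurent m) : Module.End ℂ (Laurent m) :=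
  (Finsupp.linearCombination ℂ F) ∘ₗ (AddMonoidAlgebra.coeffLinearEquiv ℂ).toLinearMap

theorem linOp_mono {m : ℕ} (F : (Fin (m + 1) → ℤ) → Laurent m) (μ : Fin (m + 1) → ℤ) :
    linOp F (mono μ) = F μ := by
  simp [linOp, mono]

theorem end_ext {m : ℕ} {A B : Module.End ℂ (Laurent m)}
    (h : ∀ μ : Fin (m + 1) → ℤ, A (mono μ) = B (mono μ)) : A = B := by
  refine LinearMap.ext fun x => ?_
  induction x using AddMonoidAlgebra.induction_linear with
  | zero => simp
  | add f g hf hg => rw [map_add, map_add, hf, hg]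
  | single μ c =>
    have hc : (AddMonoidAlgebra.single μ c : Laurent m) = c • mono μ := by simp [mono]
    rw [hc, map_smul, map_smul, h]

/-- The action of a permutation on Laurent polynomials by permuting the variables: `z` sends the
variable with index `j` to the variable with index `z j`. -/
def permOp {m : ℕ} (z : Equiv.Perm (Fin (m + 1))) : Module.End ℂ (Laurent m) :=
  linOp fun μ => mono (act z μ)

/-- The operator `T_{q⁻¹, xₙ}`, that is, `h(x₁, …, xₙ) ↦ h(x₁, …, xₙ₋₁, q⁻¹ xₙ)`. -/
def shiftOp {m : ℕ} (q : ℂ) : Module.End ℂ (Laurent m) :=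
  linOp fun μ => q ^ (-μ (Fin.last m)) • mono μ

/-- The exponent obtained from `μ` by replacing the entries at positions `i, i + 1` by `a, b`. -/
def setPair {m : ℕ} (i : Fin m) (μ : Fin (m + 1) → ℤ) (a b : ℤ) : Fin (m + 1) → ℤ :=
  Function.update (Function.update μ i.castSucc a) i.succ b

/-- The operator `h ↦ (h - sᵢ h) / (xᵢ - xᵢ₊₁)`, given on a monomial by the geometric sum that
results from the division; see `divDiff_spec`. -/
def divDiff {m : ℕ} (i : Fin m) : Module.End ℂ (Laurent m) :=
  linOp fun μ =>
    (∑ k ∈ Finset.range (μ i.castSucc - μ i.succ).toNat,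
      mono (setPair i μ (μ i.castSucc - 1 - k) (μ i.succ + k))) -
    ∑ k ∈ Finset.range (μ i.succ - μ i.castSucc).toNat,
      mono (setPair i μ (μ i.succ - 1 - k) (μ i.castSucc + k))

theorem mono_mul {m : ℕ} (μ ν : Fin (m + 1) → ℤ) : mono μ * mono ν = mono (μ + ν) := by
  simp [mono, AddMonoidAlgebra.single_mul_single]

theorem var_sub_mul_setPair {m : ℕ} (i : Fin m) (μ : Fin (m + 1) → ℤ) (a b : ℤ) :
    (var i.castSucc - var i.succ) * mono (setPair i μ a b) =
      mono (setPair i μ (a + 1) b) - mono (setPair i μ a (b + 1)) := by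
  have hne : i.castSucc ≠ i.succ := Fin.castSucc_lt_succ.ne
  rw [sub_mul, var, var, mono_mul, mono_mul]
  congr 2
  · funext j
    by_cases h1 : j = i.succ
    · subst h1; simp [setPair, hne.symm]
    · by_cases h2 : j = i.castSucc
      · subst h2; simp [setPair, hne, add_comm]
      · simp [setPair, h1, h2]
  · funext j
    by_cases h1 : j = i.succ
    · subst h1; simp [setPair, add_comm]
    · by_cases h2 : j = i.castSucc
      · subst h2; simp [setPair, hne]
      · simp [setPair, h1, h2]

theorem var_sub_mul_sum {m : ℕ} (i : Fin m) (μ : Fin (m + 1) → ℤ) (a b : ℤ) (N : ℕ) :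
    (var i.castSucc - var i.succ) *
        ∑ k ∈ Finset.range N, mono (setPair i μ (a - 1 - k) (b + k)) =
      mono (setPair i μ a b) - mono (setPair i μ (a - N) (b + N)) := by
  induction N with
  | zero => simp
  | succ N ih =>
    rw [Finset.sum_range_succ, mul_add, ih, var_sub_mul_setPair]
    have h1 : a - 1 - (N : ℤ) + 1 = a - N := by ring
    have h2 : a - 1 - (N : ℤ) = a - ((N + 1 : ℕ) : ℤ) := by push_cast; ring
    have h3 : b + (N : ℤ) + 1 = b + ((N + 1 : ℕ) : ℤ) := by push_cast; ring
    rw [h1, h2, h3]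
    abel

theorem setPair_self {m : ℕ} (i : Fin m) (μ : Fin (m + 1) → ℤ) :
    setPair i μ (μ i.castSucc) (μ i.succ) = μ := by
  simp [setPair]

theorem setPair_swap {m : ℕ} (i : Fin m) (μ : Fin (m + 1) → ℤ) :
    setPair i μ (μ i.succ) (μ i.castSucc) = act (s i) μ := by
  have hne : i.castSucc ≠ i.succ := Fin.castSucc_lt_succ.ne
  funext j
  by_cases h1 : j = i.succ
  · subst h1; simp [setPair, act, s]
  · by_cases h2 : j = i.castSucc
    · subst h2; simp [setPair, act, s, hne]
    · simp [setPair, act, s, h1, h2, Equiv.swap_apply_of_ne_of_ne]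

theorem divDiff_spec {m : ℕ} (i : Fin m) (h : Laurent m) :
    (var i.castSucc - var i.succ) * divDiff i h = h - permOp (s i) h := by
  have key : LinearMap.mulLeft ℂ (var i.castSucc - var i.succ) * divDiff i =
      (1 - permOp (s i) : Module.End ℂ (Laurent m)) := by
    refine end_ext fun μ => ?_
    rw [Module.End.mul_apply, LinearMap.mulLeft_apply, LinearMap.sub_apply, Module.End.one_apply,
      divDiff, permOp, linOp_mono, linOp_mono, mul_sub, var_sub_mul_sum, var_sub_mul_sum,
      setPair_self, setPair_swap]
    rcases le_total (μ i.succ) (μ i.castSucc) with hle | hle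
    · have e1 : ((μ i.castSucc - μ i.succ).toNat : ℤ) = μ i.castSucc - μ i.succ :=
        Int.toNat_of_nonneg (by omega)
      have e2 : ((μ i.succ - μ i.castSucc).toNat : ℤ) = 0 := by omega
      rw [e1, e2]
      simp [setPair_swap]
    · have e1 : ((μ i.succ - μ i.castSucc).toNat : ℤ) = μ i.succ - μ i.castSucc :=
        Int.toNat_of_nonneg (by omega)
      have e2 : ((μ i.castSucc - μ i.succ).toNat : ℤ) = 0 := by omega
      rw [e1, e2]
      simp [setPair_self]
  exact LinearMap.congr_fun key h

/-- The operator `Tᵢ = t^(-1/2) (t - (t xᵢ - xᵢ₊₁) / (xᵢ - xᵢ₊₁) (1 - sᵢ))`, where `u = t^(1/2)`. -/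
def T {m : ℕ} (u : ℂ) (i : Fin m) : Module.End ℂ (Laurent m) :=
  u⁻¹ • (u ^ 2 • (1 : Module.End ℂ (Laurent m)) -
    LinearMap.mulLeft ℂ (u ^ 2 • var i.castSucc - var i.succ) * divDiff i)

/-- The operator `g = s₁ s₂ ⋯ sₙ₋₁ T_{q⁻¹, xₙ}`. -/
def g {m : ℕ} (q : ℂ) : Module.End ℂ (Laurent m) :=
  (List.ofFn fun i : Fin m => permOp (s i)).prod * shiftOp q

/-- The Cherednik-Dunkl operators: `Y₁ = g Tₙ₋₁ ⋯ T₁` and `Yᵢ₊₁ = Tᵢ⁻¹ Yᵢ Tᵢ⁻¹`. -/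
def Y {m : ℕ} (q u : ℂ) : Fin (m + 1) → Module.End ℂ (Laurent m) :=
  Fin.induction (g q * (List.ofFn fun i : Fin m => T u i).reverse.prod)
    fun i Yi => Ring.inverse (T u i) * Yi * Ring.inverse (T u i)

/-- `T_z = T_{i₁} ⋯ T_{iₗ}` for a reduced word `z = s_{i₁} ⋯ s_{iₗ}`. -/
def TPerm {m : ℕ} (u : ℂ) (z : Equiv.Perm (Fin (m + 1))) : Module.End ℂ (Laurent m) :=
  ((exists_isReducedWord z).choose.map (T u)).prod

/-! ### Nonsymmetric Macdonald polynomials -/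

/-- The defining conditions of the nonsymmetric Macdonald polynomial `E_μ`:
`Yᵢ E = q^(-μᵢ) t^(-(v_μ(i) - 1) + (n - 1) / 2) E` for all `i`, and the coefficient of `x^μ` in `E`
is `1`. As `vPerm μ i` is counted from `0`, it stands for `v_μ(i) - 1`; also `n - 1 = m`. -/
def IsMacdonaldE {m : ℕ} (q u : ℂ) (μ : Fin (m + 1) → ℤ) (E : Laurent m) : Prop :=
  (∀ i, Y q u i E =
    (q ^ (-μ i) * u ^ (-2 * ((vPerm μ i : ℕ) : ℤ) + (m : ℤ))) • E) ∧
  E.coeff μ = 1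

/-- The nonsymmetric Macdonald polynomial `E_μ`, the element with the defining conditions
(where there is one). -/
def macdonaldE {m : ℕ} (q u : ℂ) (μ : Fin (m + 1) → ℤ) : Laurent m :=
  Classical.epsilon (IsMacdonaldE q u μ)

/-- `f_μ = t^(ℓ(z_μ) / 2) T_{z_μ} E_λ`, where `λ` is the weakly decreasing rearrangement of `μ`. -/
def f {m : ℕ} (q u : ℂ) (μ : Fin (m + 1) → ℤ) : Laurent m :=
  u ^ length (zPerm μ) • TPerm u (zPerm μ) (macdonaldE q u (decr μ))

/-- The rotation `(μₙ, μ₁, …, μₙ₋₁)` of `μ`. -/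
def rot {m : ℕ} (μ : Fin (m + 1) → ℤ) : Fin (m + 1) → ℤ :=
  Fin.cons (μ (Fin.last m)) (Fin.init μ)

end KZ

end

/-!
The Demazure-Lusztig operators `Tᵢ` satisfy the relations of the Hecke algebra, and the rotation
operator `g` is a ring homomorphism, conjugation by which shifts their indices by one (`DL_braid`,
`g_mul_T`, `g_mul_g_mul_T`). It follows formally that the operators `Yₖ` commute (`commute_Y`).

Order the monomials by the squared length of the exponent and, for equal length, by the sum of the
entries weighted by their positions (`rank`). This order is simpler than the usual one, but it
suffices: in `Yₖ = (Tₖ₋₁⁻¹ ⋯ T₁⁻¹) g (Tₙ₋₁ ⋯ Tₖ)`, the entry at position `k` travels once around and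
meets every other entry once. Up to terms of smaller length, it either passes that entry, or is
left behind while the other entry travels on; the latter occurs only if it brings the larger of the
two further to the left, which lowers the weighted sum. Hence `Yₖ` is triangular, and the factors
picked up on the way give the diagonal entries `q^(-μₖ) t^(-(v_μ(k) - 1) + (n - 1) / 2)`
(`isTriangular_Y`).

Under the hypothesis on `q` and `t` these joint eigenvalues are distinct for distinct `μ`, by the
rearrangement inequality (`eq_of_eigenvalues_eq`); here `t` may be a root of unity. So a joint
eigenvector is determined by its leading coefficient (`leading_of_eigenvector`), and `E_μ` is
obtained by applying to `x^μ` a product of suitable operators `Yₖ - c` that annihilates all lower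
monomials (`exists_annihilator`).

For the KZ relations, `T_z` does not depend on the reduced word (`prod_eq_of_isReducedWord`), and
`Tⱼ E_λ = t^(1/2) E_λ` whenever `λⱼ = λⱼ₊₁` (`T_macdonaldE`). As `z_μ⁻¹` is the stable sorting of
`μ` into decreasing order, the relations for `Tᵢ` are statements on lengths. The relation for `g`
reduces, by `g Tᵢ = Tᵢ₊₁ g`, to exponents that are weakly decreasing except for their last entry;
for these it is the eigenvalue equation of some `Yₖ` on `E_λ`, rewritten as a relation between
`g Tₙ₋₁ ⋯ Tₖ E_λ` and `T₁ ⋯ Tₖ₋₁ E_λ`.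
-/

noncomputable section

namespace KZ

variable {m : ℕ}

/-! ### Permutations and the rotation as ring homomorphisms -/

theorem act_mul (y z : Equiv.Perm (Fin (m + 1))) (μ : Fin (m + 1) → ℤ) :
    act (y * z) μ = act y (act z μ) := by
  funext j; simp [act]

theorem act_one (μ : Fin (m + 1) → ℤ) : act 1 μ = μ := by
  funext j; simp [act]

theorem act_add (z : Equiv.Perm (Fin (m + 1))) (μ ν : Fin (m + 1) → ℤ) :
    act z (μ + ν) = act z μ + act z ν := rfl

theorem act_apply_apply (z : Equiv.Perm (Fin (m + 1))) (μ : Fin (m + 1) → ℤ) (j : Fin (m + 1)) :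
    act z μ (z j) = μ j := by
  simp [act]

theorem permOp_mono (z : Equiv.Perm (Fin (m + 1))) (μ : Fin (m + 1) → ℤ) :
    permOp z (mono μ) = mono (act z μ) := linOp_mono _ _

theorem permOp_mul (y z : Equiv.Perm (Fin (m + 1))) :
    permOp (y * z) = permOp y * permOp z :=
  end_ext fun μ => by simp [permOp_mono, act_mul]

theorem permOp_one : permOp (1 : Equiv.Perm (Fin (m + 1))) = 1 :=
  end_ext fun μ => by simp [permOp_mono, act_one]

theorem permOp_var (z : Equiv.Perm (Fin (m + 1))) (j : Fin (m + 1)) :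
    permOp z (var j) = var (z j) := by
  rw [var, permOp_mono, var]
  congr 1
  funext k
  by_cases h : k = z j
  · subst h; simp [act]
  · have h' : z⁻¹ k ≠ j := fun e => h (by simp [← e])
    rw [act, Pi.single_eq_of_ne h, Pi.single_eq_of_ne h']

/-- A linear operator that is multiplicative on monomials is multiplicative. -/
theorem map_mul_of_mono {G : Module.End ℂ (Laurent m)}
    (h : ∀ μ ν, G (mono (μ + ν)) = G (mono μ) * G (mono ν)) (a b : Laurent m) :
    G (a * b) = G a * G b := by
  have key : ∀ a : Laurent m, G * LinearMap.mulLeft ℂ a = LinearMap.mulLeft ℂ (G a) * G := by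
    intro a
    refine end_ext fun ν => ?_
    have h2 : G * LinearMap.mulRight ℂ (mono ν) = LinearMap.mulRight ℂ (G (mono ν)) * G :=
      end_ext fun μ => by simp [mono_mul, h]
    simpa using LinearMap.congr_fun h2 a
  simpa using LinearMap.congr_fun (key a) b

theorem permOp_apply_mul (z : Equiv.Perm (Fin (m + 1))) (a b : Laurent m) :
    permOp z (a * b) = permOp z a * permOp z b :=
  map_mul_of_mono (fun μ ν => by simp [permOp_mono, act_add, mono_mul]) a b

theorem s_castSucc (i : Fin m) : s i i.castSucc = i.succ := by simp [s]

theorem s_succ (i : Fin m) : s i i.succ = i.castSucc := by simp [s]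

theorem s_mul_s (i : Fin m) : s i * s i = 1 := by ext a; simp [s_s]

theorem s_inv (i : Fin m) : (s i)⁻¹ = s i := by simp [s]

theorem s_of_ne (i : Fin m) {j : Fin (m + 1)} (h1 : j ≠ i.castSucc) (h2 : j ≠ i.succ) :
    s i j = j := Equiv.swap_apply_of_ne_of_ne h1 h2

theorem permOp_s_s (i : Fin m) (h : Laurent m) : permOp (s i) (permOp (s i) h) = h := by
  rw [← Module.End.mul_apply, ← permOp_mul, s_mul_s, permOp_one, Module.End.one_apply]

theorem var_ne {i j : Fin (m + 1)} (h : i ≠ j) : (var i : Laurent m) ≠ var j := by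
  intro e
  have := AddMonoidAlgebra.coeff_inj.mpr e
  simp only [var, mono, AddMonoidAlgebra.coeff_single] at this
  have h3 := Finsupp.single_left_injective (one_ne_zero) this
  have h4 := congrFun h3 i
  simp [Pi.single_eq_of_ne h] at h4

theorem var_sub_ne_zero {i j : Fin (m + 1)} (h : i ≠ j) : (var i - var j : Laurent m) ≠ 0 :=
  sub_ne_zero.mpr (var_ne h)

instance : IsDomain (Laurent m) := NoZeroDivisors.to_isDomain _

theorem prod_ofFn_eq_partialProd {M : Type*} [Monoid M] (a : Fin m → M) :
    (List.ofFn a).prod = Fin.partialProd a (Fin.last m) := by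
  rw [Fin.partialProd, Fin.val_last, List.take_of_length_le (by simp)]

/-- `s₁ ⋯ sₖ` moves position `k` to the front and keeps the order of the other positions. -/
theorem partialProd_s_apply (k j : Fin (m + 1)) :
    ((Fin.partialProd s k j : Fin (m + 1)) : ℕ) =
      if (j : ℕ) < k then (j : ℕ) + 1 else if j = k then 0 else j := by
  induction k using Fin.induction generalizing j with
  | zero =>
    simp +contextual [Fin.partialProd_zero]
  | succ k ih =>
    rw [Fin.partialProd_succ, Equiv.Perm.mul_apply, ih]
    by_cases h1 : j = k.castSucc
    · subst h1; rw [s_castSucc]; simp [Fin.ext_iff]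
    · by_cases h2 : j = k.succ
      · subst h2; rw [s_succ]; simp
      · rw [s_of_ne k h1 h2]
        simp only [Fin.ext_iff, Fin.val_castSucc, Fin.val_succ] at *
        split_ifs <;> omega

theorem partialProd_map_permOp (a : Fin m → Equiv.Perm (Fin (m + 1))) (k : Fin (m + 1)) :
    Fin.partialProd (fun i => permOp (a i)) k = permOp (Fin.partialProd a k) := by
  induction k using Fin.induction with
  | zero => simp [Fin.partialProd_zero, permOp_one]
  | succ k ih => simp [Fin.partialProd_succ, permOp_mul, ih]

theorem rot_zero (μ : Fin (m + 1) → ℤ) : rot μ 0 = μ (Fin.last m) := rfl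

theorem rot_succ (μ : Fin (m + 1) → ℤ) (i : Fin m) : rot μ i.succ = μ i.castSucc := rfl

theorem act_partialProd_s_last (μ : Fin (m + 1) → ℤ) :
    act (Fin.partialProd s (Fin.last m)) μ = rot μ := by
  have key : ∀ j, act (Fin.partialProd s (Fin.last m)) μ (Fin.partialProd s (Fin.last m) j) =
      rot μ (Fin.partialProd s (Fin.last m) j) := by
    intro j
    rw [act_apply_apply]
    induction j using Fin.lastCases with
    | last =>
      have : Fin.partialProd s (Fin.last m) (Fin.last m) = 0 := by
        ext; rw [partialProd_s_apply]; simp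
      rw [this, rot_zero]
    | cast j =>
      have : Fin.partialProd s (Fin.last m) j.castSucc = j.succ := by
        ext; rw [partialProd_s_apply]; simp
      rw [this, rot_succ]
  funext k
  simpa using key ((Fin.partialProd s (Fin.last m))⁻¹ k)

theorem g_mono (q : ℂ) (μ : Fin (m + 1) → ℤ) :
    g q (mono μ) = q ^ (-μ (Fin.last m)) • mono (rot μ) := by
  rw [g, prod_ofFn_eq_partialProd, partialProd_map_permOp, Module.End.mul_apply, shiftOp,
    linOp_mono, map_smul, permOp_mono, act_partialProd_s_last]

theorem rot_add (μ ν : Fin (m + 1) → ℤ) : rot (μ + ν) = rot μ + rot ν := by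
  funext j
  refine Fin.cases ?_ (fun i => ?_) j <;> simp [rot_zero, rot_succ]

theorem g_apply_mul {q : ℂ} (hq : q ≠ 0) (a b : Laurent m) : g q (a * b) = g q a * g q b :=
  map_mul_of_mono (fun μ ν => by
    rw [g_mono, g_mono, g_mono, smul_mul_smul_comm, mono_mul, rot_add, ← zpow_add₀ hq]
    congr 2
    simp [add_comm]) a b

theorem g_var_castSucc (q : ℂ) (i : Fin m) : g q (var i.castSucc) = var i.succ := by
  rw [var, g_mono, var, Pi.single_eq_of_ne (Fin.castSucc_lt_last i).ne']
  simp only [neg_zero, zpow_zero, one_smul]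
  congr 1
  funext j
  refine Fin.cases ?_ (fun k => ?_) j
  · rw [rot_zero, Pi.single_eq_of_ne (Fin.castSucc_lt_last i).ne',
      Pi.single_eq_of_ne (Fin.succ_ne_zero i).symm]
  · rw [rot_succ]
    simp [Pi.single_apply]

theorem g_var_last (q : ℂ) : g q (var (Fin.last m)) = q⁻¹ • var 0 := by
  rw [var, g_mono, var, Pi.single_eq_same]
  simp only [zpow_neg, zpow_one]
  congr 2
  funext j
  refine Fin.cases ?_ (fun k => ?_) j
  · simp [rot_zero]
  · rw [rot_succ, Pi.single_eq_of_ne (Fin.castSucc_lt_last k).ne,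
      Pi.single_eq_of_ne (Fin.succ_ne_zero k)]

/-! ### Relations between the Demazure-Lusztig operators -/

/-- The operator `t - (t xᵢ - xᵢ₊₁) / (xᵢ - xᵢ₊₁) (1 - sᵢ)`, that is, `t^(1/2) Tᵢ`. This
normalization contains no square root of `t`. -/
def DL (t : ℂ) (i : Fin m) : Module.End ℂ (Laurent m) :=
  t • (1 : Module.End ℂ (Laurent m)) -
    LinearMap.mulLeft ℂ (t • var i.castSucc - var i.succ) * divDiff i

theorem T_eq (u : ℂ) (i : Fin m) : T u i = u⁻¹ • DL (u ^ 2) i := rfl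

theorem DL_apply (t : ℂ) (i : Fin m) (h : Laurent m) :
    DL t i h = t • h - (t • var i.castSucc - var i.succ) * divDiff i h := by
  simp [DL]

/-- The defining formula of `DL`, with its denominator cleared; as the Laurent polynomial ring is a
domain, it determines the operator. -/
theorem DL_spec (t : ℂ) (i : Fin m) (h : Laurent m) :
    (var i.castSucc - var i.succ) * DL t i h =
      ((1 - t) • var i.succ) * h + (t • var i.castSucc - var i.succ) * permOp (s i) h := by
  have e := divDiff_spec i h
  rw [DL_apply]
  simp only [Algebra.smul_def, map_sub, map_one]
  linear_combination
    (-(algebraMap ℂ (Laurent m) t * var i.castSucc - var i.succ)) * e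

theorem var_castSucc_sub_ne_zero (i : Fin m) : (var i.castSucc - var i.succ : Laurent m) ≠ 0 :=
  var_sub_ne_zero Fin.castSucc_lt_succ.ne

/-- `DL` commutes with the multiplication by an `sᵢ`-invariant element. -/
theorem DL_mul_of_invariant (t : ℂ) (i : Fin m) {a : Laurent m} (ha : permOp (s i) a = a)
    (h : Laurent m) : DL t i (a * h) = a * DL t i h := by
  apply mul_left_cancel₀ (var_castSucc_sub_ne_zero i)
  have e1 := DL_spec t i h
  rw [DL_spec, permOp_apply_mul, ha]
  linear_combination (-a) * e1

/-- A multiplicative operator carrying the pair of variables `xᵢ, xᵢ₊₁` to a common multiple of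
`xⱼ, xⱼ₊₁` intertwines the corresponding operators. -/
theorem mul_DL_of_intertwines (t : ℂ) {i j : Fin m} {G : Module.End ℂ (Laurent m)}
    (hG : ∀ a b, G (a * b) = G a * G b) {c : ℂ} (hc : c ≠ 0)
    (h1 : G (var i.castSucc) = c • var j.castSucc) (h2 : G (var i.succ) = c • var j.succ)
    (hs : G * permOp (s i) = permOp (s j) * G) : G * DL t i = DL t j * G := by
  refine LinearMap.ext fun h => ?_
  have hs' : G (permOp (s i) h) = permOp (s j) (G h) := LinearMap.congr_fun hs h
  simp only [Module.End.mul_apply]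
  apply mul_left_cancel₀ (var_castSucc_sub_ne_zero j)
  rw [DL_spec]
  have e := congrArg G (DL_spec t i h)
  rw [hG, map_add, hG, hG, map_sub, map_smul, map_sub, map_smul, h1, h2, hs'] at e
  have hc' : algebraMap ℂ (Laurent m) c ≠ 0 := by
    simpa using hc
  apply mul_left_cancel₀ hc'
  simp only [Algebra.smul_def] at e ⊢
  linear_combination e

theorem DL_apply_permOp (t : ℂ) (i : Fin m) (h : Laurent m) :
    DL t i (permOp (s i) h) = t • permOp (s i) h + t • h - DL t i h := by
  apply mul_left_cancel₀ (var_castSucc_sub_ne_zero i)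
  have e1 := DL_spec t i h
  have e2 := DL_spec t i (permOp (s i) h)
  rw [permOp_s_s] at e2
  simp only [Algebra.smul_def, map_sub, map_one] at *
  linear_combination e1 + e2

theorem DL_sq (t : ℂ) (i : Fin m) :
    DL t i * DL t i = (t - 1) • DL t i + t • (1 : Module.End ℂ (Laurent m)) := by
  refine LinearMap.ext fun h => ?_
  simp only [Module.End.mul_apply, LinearMap.add_apply, LinearMap.smul_apply, Module.End.one_apply]
  have e1 := DL_spec t i h
  have e2 := DL_spec t i (DL t i h)
  have e3 := congrArg (permOp (s i)) e1
  rw [permOp_apply_mul, map_add, permOp_apply_mul, permOp_apply_mul, map_sub, map_smul, map_sub,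
    map_smul, permOp_var, permOp_var, s_castSucc, s_succ, permOp_s_s] at e3
  apply mul_left_cancel₀ (var_castSucc_sub_ne_zero i)
  apply mul_left_cancel₀ (var_castSucc_sub_ne_zero i)
  simp only [Algebra.smul_def, map_sub, map_one] at *
  linear_combination (var i.castSucc - var i.succ) * e2 +
    (((1 - algebraMap ℂ (Laurent m) t) * var i.succ) -
      (algebraMap ℂ (Laurent m) t - 1) * (var i.castSucc - var i.succ)) * e1 -
    (algebraMap ℂ (Laurent m) t * var i.castSucc - var i.succ) * e3

theorem s_mul_s_comm {i j : Fin m} (h1 : i.castSucc ≠ j.succ) (h2 : j.castSucc ≠ i.succ)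
    (h : i ≠ j) : s i * s j = s j * s i := by
  refine (Equiv.Perm.disjoint_swap_swap ?_).commute
  simp only [List.nodup_cons, List.mem_cons, List.not_mem_nil, or_false, not_or]
  simp only [Fin.ext_iff, Fin.val_castSucc, Fin.val_succ, ne_eq] at *
  refine ⟨⟨?_, ?_, ?_⟩, ⟨?_, ?_⟩, ?_, ?_⟩ <;> first | omega | simp

theorem DL_comm (t : ℂ) {i j : Fin m} (h1 : i.castSucc ≠ j.succ) (h2 : j.castSucc ≠ i.succ)
    (h : i ≠ j) : DL t i * DL t j = DL t j * DL t i := by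
  refine LinearMap.ext fun h' => ?_
  simp only [Module.End.mul_apply]
  have hv1 : permOp (s i) (var j.castSucc) = (var j.castSucc : Laurent m) := by
    rw [permOp_var, s_of_ne]
    · simpa [Fin.ext_iff] using fun e => h (Fin.ext e.symm)
    · exact h2
  have hv2 : permOp (s i) (var j.succ) = (var j.succ : Laurent m) := by
    rw [permOp_var, s_of_ne]
    · exact h1.symm
    · simpa [Fin.ext_iff] using fun e => h (Fin.ext e.symm)
  have hs : DL t i (permOp (s j) h') = permOp (s j) (DL t i h') := by
    have hw1 : permOp (s j) (var i.castSucc) = (1 : ℂ) • (var i.castSucc : Laurent m) := by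
      rw [permOp_var, s_of_ne, one_smul]
      · simpa [Fin.ext_iff] using fun e => h (Fin.ext e)
      · exact h1
    have hw2 : permOp (s j) (var i.succ) = (1 : ℂ) • (var i.succ : Laurent m) := by
      rw [permOp_var, s_of_ne, one_smul]
      · exact h2.symm
      · simpa [Fin.ext_iff] using fun e => h (Fin.ext e)
    have := mul_DL_of_intertwines t (permOp_apply_mul (s j)) one_ne_zero hw1 hw2
      (by rw [← permOp_mul, ← permOp_mul, s_mul_s_comm h1 h2 h])
    exact (LinearMap.congr_fun this h').symm
  apply mul_left_cancel₀ (var_castSucc_sub_ne_zero j)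
  rw [← DL_mul_of_invariant t i (by rw [map_sub, hv1, hv2]), DL_spec, DL_spec, map_add,
    DL_mul_of_invariant t i (by rw [map_smul, hv2]),
    DL_mul_of_invariant t i (by rw [map_sub, map_smul, hv1, hv2]), hs]

/-- The rational function identity behind the braid relation. The elements `h w` stand for the
images of an element under the symmetric group on three letters, and `p`, `r`, `v` for the values of
the three successive operators; the primed letters belong to the other side of the relation. -/
theorem braid_field {K : Type*} [Field K] {t x y z h h1 h2 h12 h21 h121 : K}
    {p p1 p2 p12 r r1 v p' p1' p2' p21' r' r2' v' : K}
    (hxy : x - y ≠ 0) (hxz : x - z ≠ 0) (hyz : y - z ≠ 0)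
    (ep : (x - y) * p = (1 - t) * y * h + (t * x - y) * h1)
    (ep1 : (y - x) * p1 = (1 - t) * x * h1 + (t * y - x) * h)
    (ep2 : (x - z) * p2 = (1 - t) * z * h2 + (t * x - z) * h21)
    (ep12 : (y - z) * p12 = (1 - t) * z * h12 + (t * y - z) * h121)
    (er : (y - z) * r = (1 - t) * z * p + (t * y - z) * p2)
    (er1 : (x - z) * r1 = (1 - t) * z * p1 + (t * x - z) * p12)
    (ev : (x - y) * v = (1 - t) * y * r + (t * x - y) * r1)
    (ep' : (y - z) * p' = (1 - t) * z * h + (t * y - z) * h2)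
    (ep1' : (x - z) * p1' = (1 - t) * z * h1 + (t * x - z) * h12)
    (ep2' : (z - y) * p2' = (1 - t) * y * h2 + (t * z - y) * h)
    (ep21' : (x - y) * p21' = (1 - t) * y * h21 + (t * x - y) * h121)
    (er' : (x - y) * r' = (1 - t) * y * p' + (t * x - y) * p1')
    (er2' : (x - z) * r2' = (1 - t) * z * p2' + (t * x - z) * p21')
    (ev' : (y - z) * v' = (1 - t) * z * r' + (t * y - z) * r2') : v = v' := by
  have hyx : y - x ≠ 0 := by rwa [← neg_sub, neg_ne_zero]
  have hzy : z - y ≠ 0 := by rwa [← neg_sub, neg_ne_zero]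
  have solve : ∀ {a b c : K}, a ≠ 0 → a * b = c → b = c / a := by
    intro a b c ha e
    rw [eq_div_iff ha, mul_comm, e]
  have fp := solve hxy ep
  have fp1 := solve hyx ep1
  have fp2 := solve hxz ep2
  have fp12 := solve hyz ep12
  have fr := solve hyz er
  have fr1 := solve hxz er1
  have fv := solve hxy ev
  have fp' := solve hyz ep'
  have fp1' := solve hxz ep1'
  have fp2' := solve hzy ep2'
  have fp21' := solve hxy ep21'
  have fr' := solve hxy er'
  have fr2' := solve hxz er2'
  have fv' := solve hyz ev'
  rw [← neg_sub x y] at fp1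
  rw [← neg_sub y z] at fp2'
  rw [fv, fv', fr, fr1, fr', fr2', fp, fp1, fp2, fp12, fp', fp1', fp2', fp21']
  clear ep ep1 ep2 ep12 er er1 ev ep' ep1' ep2' ep21' er' er2' ev'
  clear fp fp1 fp2 fp12 fr fr1 fv fp' fp1' fp2' fp21' fr' fr2' fv'
  field_simp
  ring

theorem s_braid {i j : Fin m} (h : j.castSucc = i.succ) :
    s i * s j * s i = s j * s i * s j := by
  ext a
  simp only [Equiv.Perm.mul_apply, s, h, Equiv.swap_apply_def]
  simp only [Fin.ext_iff, Fin.val_castSucc, Fin.val_succ] at *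
  split_ifs <;> simp at * <;> omega

theorem DL_braid (t : ℂ) {i j : Fin m} (hij : j.castSucc = i.succ) :
    DL t i * DL t j * DL t i = DL t j * DL t i * DL t j := by
  refine LinearMap.ext fun h => ?_
  simp only [Module.End.mul_apply]
  apply IsFractionRing.injective (Laurent m) (FractionRing (Laurent m))
  have hval : (j : ℕ) = i + 1 := by simpa [Fin.ext_iff] using hij
  have hxz : i.castSucc ≠ j.succ := by simp [Fin.ext_iff]; omega
  have hyz : i.succ ≠ j.succ := by rw [← hij]; exact Fin.castSucc_lt_succ.ne
  have hxy : i.castSucc ≠ i.succ := Fin.castSucc_lt_succ.ne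
  have s1x := s_castSucc i
  have s1y := s_succ i
  have s1z : s i j.succ = j.succ := s_of_ne i hxz.symm hyz.symm
  have s2x : s j i.castSucc = i.castSucc := s_of_ne j (by rw [hij]; exact hxy) hxz
  have s2y : s j i.succ = j.succ := by rw [← hij, s_castSucc]
  have s2z : s j j.succ = i.succ := by rw [s_succ, hij]
  have A := DL_spec t i
  have B := DL_spec t j
  rw [hij] at B
  have C : ∀ (k : Fin m) (w h : Laurent m) (a b c d : Laurent m),
      a * w = b * h + c * d → permOp (s k) a * permOp (s k) w =
        permOp (s k) b * permOp (s k) h + permOp (s k) c * permOp (s k) d := by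
    intro k w h a b c d e
    rw [← permOp_apply_mul, e, map_add, permOp_apply_mul, permOp_apply_mul]
  have h121 : permOp (s j) (permOp (s i) (permOp (s j) h)) =
      permOp (s i) (permOp (s j) (permOp (s i) h)) := by
    simp only [← Module.End.mul_apply, ← permOp_mul]
    rw [← mul_assoc, ← mul_assoc, s_braid hij]
  have e : ∀ a b : Laurent m, a = b → algebraMap (Laurent m) (FractionRing (Laurent m)) a =
    algebraMap _ _ b := fun a b h => by rw [h]
  have ep := e _ _ (A h)
  have ep1 := e _ _ (C i _ _ _ _ _ _ (A h))
  have ep2 := e _ _ (C j _ _ _ _ _ _ (A h))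
  have ep12 := e _ _ (C i _ _ _ _ _ _ (C j _ _ _ _ _ _ (A h)))
  have er := e _ _ (B (DL t i h))
  have er1 := e _ _ (C i _ _ _ _ _ _ (B (DL t i h)))
  have ev := e _ _ (A (DL t j (DL t i h)))
  have ep' := e _ _ (B h)
  have ep1' := e _ _ (C i _ _ _ _ _ _ (B h))
  have ep2' := e _ _ (C j _ _ _ _ _ _ (B h))
  have ep21' := e _ _ (C j _ _ _ _ _ _ (C i _ _ _ _ _ _ (B h)))
  have er' := e _ _ (A (DL t j h))
  have er2' := e _ _ (C j _ _ _ _ _ _ (A (DL t j h)))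
  have ev' := e _ _ (B (DL t i (DL t j h)))
  simp only [map_sub, map_smul, permOp_var, s1x, s1y, s1z, s2x, s2y, s2z, permOp_s_s,
    h121] at ep ep1 ep2 ep12 er er1 ev ep' ep1' ep2' ep21' er' er2' ev'
  simp only [map_sub, Algebra.smul_def, map_mul, map_add,
    map_one] at ep ep1 ep2 ep12 er er1 ev ep' ep1' ep2' ep21' er' er2' ev'
  have hne : ∀ a b : Fin (m + 1), a ≠ b →
      algebraMap (Laurent m) (FractionRing (Laurent m)) (var a) -
        algebraMap (Laurent m) (FractionRing (Laurent m)) (var b) ≠ 0 := by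
    intro a b hab
    rw [← map_sub]
    exact (map_ne_zero_iff _ (IsFractionRing.injective _ _)).mpr (var_sub_ne_zero hab)
  exact braid_field (hne _ _ hxy) (hne _ _ hxz) (hne _ _ hyz) ep ep1 ep2 ep12 er er1 ev ep' ep1'
    ep2' ep21' er' er2' ev'

/-! ### The rotation operator and the Demazure-Lusztig operators -/

theorem act_s_apply_last {i j : Fin m} (hij : j.castSucc = i.succ) (μ : Fin (m + 1) → ℤ) :
    act (s i) μ (Fin.last m) = μ (Fin.last m) := by
  have hne : Fin.last m ≠ i.succ := by
    rw [← hij]; exact (Fin.castSucc_lt_last j).ne'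
  simp only [act, s_inv]
  rw [s_of_ne i (Fin.castSucc_lt_last i).ne' hne]

theorem rot_act_s {i j : Fin m} (hij : j.castSucc = i.succ) (μ : Fin (m + 1) → ℤ) :
    rot (act (s i) μ) = act (s j) (rot μ) := by
  funext k
  refine Fin.cases ?_ (fun k => ?_) k
  · rw [rot_zero, act_s_apply_last hij]
    simp only [act, s_inv]
    rw [s_of_ne j, rot_zero]
    · rw [hij]; exact (Fin.succ_ne_zero i).symm
    · exact (Fin.succ_ne_zero j).symm
  · rw [rot_succ]
    simp only [act, s_inv]
    by_cases h1 : k = i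
    · subst h1
      rw [s_castSucc, ← hij, s_castSucc, rot_succ]
    · by_cases h2 : k = j
      · subst h2
        rw [hij, s_succ, s_succ, hij, rot_succ]
      · rw [s_of_ne i, s_of_ne j, rot_succ]
        · rw [hij]; simpa using h1
        · simpa using h2
        · simpa using h1
        · rw [← hij]; simpa using h2

theorem g_mul_DL {q : ℂ} (hq : q ≠ 0) (t : ℂ) {i j : Fin m} (hij : j.castSucc = i.succ) :
    g q * DL t i = DL t j * g q := by
  refine mul_DL_of_intertwines t (g_apply_mul hq) one_ne_zero ?_ ?_ ?_
  · rw [g_var_castSucc, one_smul, hij]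
  · rw [← hij, g_var_castSucc, one_smul]
  · refine end_ext fun μ => ?_
    simp only [Module.End.mul_apply, permOp_mono, g_mono, map_smul, act_s_apply_last hij,
      rot_act_s hij]

theorem g_mul_g_mul_DL {q : ℂ} (hq : q ≠ 0) (t : ℂ) (i j : Fin m) (hi : i.succ = Fin.last m)
    (hj : j.castSucc = 0) : g q * g q * DL t i = DL t j * (g q * g q) := by
  have hj1 : ((j : Fin m) : ℕ) = 0 := by simpa [Fin.ext_iff] using hj
  have hi1 : (i : ℕ) + 1 = m := by simpa [Fin.ext_iff] using hi
  refine mul_DL_of_intertwines t (fun a b => ?_) (inv_ne_zero hq) ?_ ?_ ?_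
  · simp only [Module.End.mul_apply, g_apply_mul hq]
  · rw [Module.End.mul_apply, g_var_castSucc, hi, g_var_last, hj]
  · rw [Module.End.mul_apply, hi, g_var_last, map_smul, ← hj, g_var_castSucc]
  · refine end_ext fun μ => ?_
    simp only [Module.End.mul_apply, permOp_mono, g_mono, map_smul, smul_smul]
    have hlast : ∀ ν : Fin (m + 1) → ℤ, rot ν (Fin.last m) = ν i.castSucc := by
      intro ν; rw [← hi, rot_succ]
    have e : s i (Fin.last m) = i.castSucc := by rw [← hi, s_succ]
    congr 1
    · rw [hlast, hlast]
      simp only [act, s_inv, s_castSucc, e, hi]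
      rw [mul_comm]
    · congr 1
      funext k
      refine Fin.cases ?_ (fun k => ?_) k
      · rw [rot_zero, hlast]
        simp only [act, s_inv, s_castSucc, hi]
        rw [← hj, s_castSucc, rot_succ, hj, rot_zero]
      · rw [rot_succ]
        by_cases h1 : k = j
        · subst h1
          rw [hj, rot_zero]
          simp only [act, s_inv, e, s_succ]
          rw [hj, rot_zero, hlast]
        · have hk : 0 < (k : ℕ) := by
            have : (k : ℕ) ≠ j := fun e => h1 (Fin.ext e)
            omega
          obtain ⟨l, hl⟩ : ∃ l : Fin m, k.castSucc = l.succ :=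
            ⟨⟨k - 1, by omega⟩, by ext; simp; omega⟩
          have hlv : (k : ℕ) = l + 1 := by simpa [Fin.ext_iff] using hl
          rw [hl, rot_succ]
          simp only [act, s_inv]
          rw [s_of_ne j, rot_succ, hl, rot_succ, s_of_ne i]
          · simp only [Ne, Fin.ext_iff, Fin.val_castSucc]; omega
          · simp only [Ne, Fin.ext_iff, Fin.val_castSucc, Fin.val_succ]; omega
          · rw [hj]; exact Fin.succ_ne_zero k
          · simpa using h1

/-! ### The affine Hecke algebra relations -/

theorem T_sq {u : ℂ} (hu : u ≠ 0) (i : Fin m) :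
    T u i * T u i = (u - u⁻¹) • T u i + (1 : Module.End ℂ (Laurent m)) := by
  rw [T_eq, smul_mul_smul_comm, DL_sq, smul_add, smul_smul, smul_smul, smul_smul]
  have h1 : u⁻¹ * u⁻¹ * (u ^ 2 - 1) = (u - u⁻¹) * u⁻¹ := by field_simp
  have h2 : u⁻¹ * u⁻¹ * u ^ 2 = 1 := by field_simp
  rw [h1, h2, one_smul]

/-- The inverse of `Tᵢ`. -/
def Tinv (u : ℂ) (i : Fin m) : Module.End ℂ (Laurent m) :=
  T u i - (u - u⁻¹) • (1 : Module.End ℂ (Laurent m))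

theorem T_mul_Tinv {u : ℂ} (hu : u ≠ 0) (i : Fin m) : T u i * Tinv u i = 1 := by
  rw [Tinv, mul_sub, T_sq hu, mul_smul_comm, mul_one, add_sub_cancel_left]

theorem Tinv_mul_T {u : ℂ} (hu : u ≠ 0) (i : Fin m) : Tinv u i * T u i = 1 := by
  rw [Tinv, sub_mul, T_sq hu, smul_mul_assoc, one_mul, add_sub_cancel_left]

theorem inverse_T {u : ℂ} (hu : u ≠ 0) (i : Fin m) : Ring.inverse (T u i) = Tinv u i :=
  Ring.inverse_unit (⟨T u i, Tinv u i, T_mul_Tinv hu i, Tinv_mul_T hu i⟩ : (Module.End ℂ _)ˣ)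

theorem T_braid (u : ℂ) {i j : Fin m} (hij : j.castSucc = i.succ) :
    T u i * T u j * T u i = T u j * T u i * T u j := by
  simp only [T_eq, smul_mul_smul_comm, DL_braid (u ^ 2) hij]

theorem T_comm (u : ℂ) {i j : Fin m} (hij : (i : ℕ) + 2 ≤ j) : Commute (T u i) (T u j) := by
  have := DL_comm (u ^ 2) (i := i) (j := j)
    (by simp only [Ne, Fin.ext_iff, Fin.val_castSucc, Fin.val_succ]; omega)
    (by simp only [Ne, Fin.ext_iff, Fin.val_castSucc, Fin.val_succ]; omega)
    (by simp only [Ne, Fin.ext_iff]; omega)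
  rw [commute_iff_eq, T_eq, T_eq, smul_mul_smul_comm, smul_mul_smul_comm, this]

theorem commute_Tinv {u : ℂ} {i : Fin m} {A : Module.End ℂ (Laurent m)} (h : Commute A (T u i)) :
    Commute A (Tinv u i) :=
  h.sub_right ((Commute.one_right A).smul_right _)

theorem g_mul_T {q : ℂ} (hq : q ≠ 0) (u : ℂ) {i j : Fin m} (hij : j.castSucc = i.succ) :
    g q * T u i = T u j * g q := by
  rw [T_eq, T_eq, mul_smul_comm, smul_mul_assoc, g_mul_DL hq _ hij]

theorem g_mul_g_mul_T {q : ℂ} (hq : q ≠ 0) (u : ℂ) (i j : Fin m) (hi : i.succ = Fin.last m)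
    (hj : j.castSucc = 0) : g q * g q * T u i = T u j * (g q * g q) := by
  rw [T_eq, T_eq, mul_smul_comm, smul_mul_assoc, g_mul_g_mul_DL hq _ i j hi hj]

/-! ### The Cherednik-Dunkl operators -/

/-- The product `Tₖ₋₁ ⋯ T₁` of the first operators, in decreasing order. -/
def headProd (u : ℂ) : Fin (m + 1) → Module.End ℂ (Laurent m) :=
  Fin.induction 1 fun i P => T u i * P

theorem headProd_zero (u : ℂ) : headProd (m := m) u 0 = 1 := rfl

theorem headProd_succ (u : ℂ) (i : Fin m) :
    headProd u i.succ = T u i * headProd u i.castSucc := rfl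

/-- The product `Tₙ₋₁ ⋯ Tₖ` of the last operators, in decreasing order. -/
def tailProd (u : ℂ) : Fin (m + 1) → Module.End ℂ (Laurent m) :=
  Fin.reverseInduction 1 fun i D => D * T u i

theorem tailProd_last (u : ℂ) : tailProd (m := m) u (Fin.last m) = 1 := by
  simp [tailProd]

theorem tailProd_castSucc (u : ℂ) (i : Fin m) :
    tailProd u i.castSucc = tailProd u i.succ * T u i := by
  simp [tailProd]

/-- The product `Tₖ₋₁⁻¹ ⋯ T₁⁻¹`. -/
def headInvProd (u : ℂ) : Fin (m + 1) → Module.End ℂ (Laurent m) :=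
  Fin.induction 1 fun i P => Tinv u i * P

theorem headInvProd_zero (u : ℂ) : headInvProd (m := m) u 0 = 1 := rfl

theorem headInvProd_succ (u : ℂ) (i : Fin m) :
    headInvProd u i.succ = Tinv u i * headInvProd u i.castSucc := rfl

theorem partialProd_T_mul_headInvProd {u : ℂ} (hu : u ≠ 0) (k : Fin (m + 1)) :
    Fin.partialProd (T u) k * headInvProd u k = 1 := by
  induction k using Fin.induction with
  | zero => simp [headInvProd_zero]
  | succ k ih =>
    rw [Fin.partialProd_succ, headInvProd_succ, mul_assoc, ← mul_assoc (T u k),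
      T_mul_Tinv hu, one_mul, ih]

theorem tailProd_mul_headProd (u : ℂ) (k : Fin (m + 1)) :
    tailProd u k * headProd u k = tailProd u 0 := by
  induction k using Fin.induction with
  | zero => rw [headProd_zero, mul_one]
  | succ k ih => rw [headProd_succ, ← mul_assoc, ← tailProd_castSucc, ih]

theorem prod_reverse_ofFn_T (u : ℂ) :
    (List.ofFn fun i : Fin m => T u i).reverse.prod = headProd u (Fin.last m) := by
  have key : ∀ k : Fin (m + 1),
      (((List.ofFn fun i : Fin m => T u i).take k).reverse).prod = headProd u k := by
    intro k
    induction k using Fin.induction with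
    | zero => simp [headProd_zero]
    | succ k ih =>
      rw [headProd_succ, ← ih]
      simp [List.take_add_one]
  rw [← key, Fin.val_last, List.take_of_length_le (by simp)]

theorem Y_succ {q u : ℂ} (hu : u ≠ 0) (i : Fin m) :
    Y q u i.succ = Tinv u i * Y q u i.castSucc * Tinv u i := by
  rw [← inverse_T hu]; rfl

theorem Y_zero (q u : ℂ) : Y (m := m) q u 0 = g q * headProd u (Fin.last m) := by
  rw [← prod_reverse_ofFn_T]; rfl

theorem headProd_last (u : ℂ) : headProd (m := m) u (Fin.last m) = tailProd u 0 := by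
  rw [← tailProd_mul_headProd u (Fin.last m), tailProd_last, one_mul]

theorem Y_eq {q u : ℂ} (hu : u ≠ 0) (k : Fin (m + 1)) :
    Y q u k = headInvProd u k * g q * tailProd u k := by
  induction k using Fin.induction with
  | zero => rw [Y_zero, headInvProd_zero, one_mul, headProd_last]
  | succ k ih =>
    rw [Y_succ hu, ih, headInvProd_succ, tailProd_castSucc]
    simp only [mul_assoc]
    rw [T_mul_Tinv hu, mul_one]

theorem commute_T_tailProd (u : ℂ) (i : Fin m) (k : Fin (m + 1)) (h : (i : ℕ) + 2 ≤ k) :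
    Commute (T u i) (tailProd u k) := by
  induction k using Fin.reverseInduction with
  | last => rw [tailProd_last]; exact Commute.one_right _
  | cast k ih =>
    rw [tailProd_castSucc]
    have h' : (i : ℕ) + 2 ≤ k := by simpa using h
    exact (ih (by simp; omega)).mul_right (T_comm u h')

theorem tailProd_mul_T (u : ℂ) {i j : Fin m} (hij : j.castSucc = i.succ) (k : Fin (m + 1))
    (hk : (k : ℕ) ≤ i) : tailProd u k * T u j = T u i * tailProd u k := by
  have hval : (j : ℕ) = i + 1 := by simpa [Fin.ext_iff] using hij
  induction k using Fin.reverseInduction with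
  | last => simp at hk; omega
  | cast k ih =>
    rcases (show (k : ℕ) ≤ i by simpa using hk).eq_or_lt with e | h
    · obtain rfl : k = i := Fin.ext e
      rw [tailProd_castSucc, ← hij, tailProd_castSucc, mul_assoc, mul_assoc, ← mul_assoc (T u j),
        ← T_braid u hij, ← mul_assoc, ← mul_assoc, ← mul_assoc, ← mul_assoc,
        (commute_T_tailProd u k j.succ (by simp; omega)).eq]
    · rw [tailProd_castSucc, mul_assoc, (T_comm u (i := k) (j := j) (by omega)).eq, ← mul_assoc,
        ih (by simp; omega), mul_assoc]

theorem Y_zero_eq (q u : ℂ) : Y (m := m) q u 0 = g q * tailProd u 0 := by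
  rw [Y_zero, headProd_last]

theorem commute_T_Y_of_lt {q u : ℂ} (hq : q ≠ 0) (hu : u ≠ 0) (j : Fin m) (k : Fin (m + 1))
    (h : (k : ℕ) < j) : Commute (T u j) (Y q u k) := by
  induction k using Fin.induction with
  | zero =>
    obtain ⟨i, hi⟩ : ∃ i : Fin m, j.castSucc = i.succ :=
      ⟨⟨j - 1, by omega⟩, by ext; simp at h ⊢; omega⟩
    rw [commute_iff_eq, Y_zero_eq, ← mul_assoc, ← g_mul_T hq u hi, mul_assoc, mul_assoc,
      tailProd_mul_T u hi 0 (by simp)]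
  | succ k ih =>
    have h' : (k : ℕ) + 2 ≤ j := by simp at h; omega
    have hc := commute_Tinv (T_comm u h').symm
    rw [Y_succ hu]
    exact (hc.mul_right (ih (by simp; omega))).mul_right hc

theorem commute_T_Y_of_gt {q u : ℂ} (hq : q ≠ 0) (hu : u ≠ 0) (i : Fin m) (k : Fin (m + 1))
    (h : (i : ℕ) + 2 ≤ k) : Commute (T u i) (Y q u k) := by
  induction k using Fin.induction with
  | zero => simp at h
  | succ j ih =>
    rcases (show (i : ℕ) + 1 ≤ j by simp at h; omega).eq_or_lt with e | h
    · have hij : j.castSucc = i.succ := by ext; simp; omega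
      have hc := commute_T_Y_of_lt hq hu (q := q) j i.castSucc (by simp; omega)
      rw [Y_succ hu, hij, Y_succ hu, commute_iff_eq]
      have hb := T_braid u hij
      have ha := Tinv_mul_T hu i
      have ha' := T_mul_Tinv hu i
      have hd := Tinv_mul_T hu j
      have hd' := T_mul_Tinv hu j
      generalize T u i = a at *
      generalize T u j = b at *
      generalize Tinv u i = a' at *
      generalize Tinv u j = b' at *
      generalize Y q u i.castSucc = y at *
      have e1 : a * b' * a' = b' * a' * b := by
        calc a * b' * a' = b' * (a' * a) * b * a * b' * a' := by
              rw [ha, mul_one, hd, one_mul]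
          _ = b' * a' * (a * b * a) * b' * a' := by simp only [mul_assoc]
          _ = b' * a' * b * (a * (b * b') * a') := by rw [hb]; simp only [mul_assoc]
          _ = b' * a' * b := by rw [hd', mul_one, ha', mul_one]
      have e2 : a' * b' * a = b * a' * b' := by
        calc a' * b' * a = a' * b' * a * b * (a * a') * b' := by
              rw [ha', mul_one, mul_assoc _ b, hd', mul_one]
          _ = a' * b' * (a * b * a) * a' * b' := by simp only [mul_assoc]
          _ = a' * (b' * b) * a * b * a' * b' := by rw [hb]; simp only [mul_assoc]
          _ = b * a' * b' := by rw [hd, mul_one, ha, one_mul]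
      calc a * (b' * (a' * y * a') * b') = (a * b' * a') * y * a' * b' := by
            simp only [mul_assoc]
        _ = b' * a' * (b * y) * a' * b' := by rw [e1]; simp only [mul_assoc]
        _ = b' * a' * y * (b * a' * b') := by rw [hc.eq]; simp only [mul_assoc]
        _ = b' * (a' * y * a') * b' * a := by rw [← e2]; simp only [mul_assoc]
    · have hc := commute_Tinv (T_comm u (i := i) (j := j) (by omega))
      rw [Y_succ hu]
      exact (hc.mul_right (ih (by simp; omega))).mul_right hc

/-- The case of `Y₁` and `Y₂`, from which all other commutation relations follow. With `R` the
product `Tₙ₋₁ ⋯ T₂` the claim reads `T₁ g R g R = g R g R T₁`, and it follows from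
`T₁ g² = g² Tₙ₋₁`. -/
theorem commute_Y_zero_Y_one {q u : ℂ} (hq : q ≠ 0) (hu : u ≠ 0) :
    Commute (Y q u 0) (Y q u (Fin.succ (0 : Fin (m + 1)))) := by
  have key : ∀ k : Fin (m + 1), ∃ R : Module.End ℂ (Laurent (m + 1)),
      headProd u k.succ = R * T u 0 ∧ R * g q = g q * headProd u k.castSucc ∧
        headProd u k.castSucc * tailProd u 0 = tailProd u 0 * R := by
    intro k
    induction k using Fin.induction with
    | zero =>
      exact ⟨1, by rw [headProd_succ, Fin.castSucc_zero, headProd_zero, mul_one, one_mul],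
        by simp [headProd_zero], by simp [headProd_zero]⟩
    | succ k ih =>
      obtain ⟨R, h1, h2, h3⟩ := ih
      have hk : (k.succ).castSucc = (k.castSucc).succ := rfl
      refine ⟨T u k.succ * R, ?_, ?_, ?_⟩
      · rw [headProd_succ, hk, h1, mul_assoc]
      · rw [mul_assoc, h2, ← mul_assoc, ← g_mul_T hq u hk, mul_assoc, hk, headProd_succ]
      · rw [hk, headProd_succ, mul_assoc, h3, ← mul_assoc, ← tailProd_mul_T u hk 0 (by simp),
          mul_assoc]
  obtain ⟨R, h1, h2, h3⟩ := key (Fin.last m)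
  rw [Fin.succ_last, headProd_last] at h1
  have h4 : T u (Fin.last m) * headProd u (Fin.last m).castSucc = tailProd u 0 := by
    rw [← headProd_succ, Fin.succ_last, headProd_last]
  have h5 := g_mul_g_mul_T hq u (Fin.last m) 0 (Fin.succ_last m) rfl
  have h6 : T u 0 * (g q * R * g q * R) = g q * R * (g q * tailProd u 0) := by
    calc T u 0 * (g q * R * g q * R) = T u 0 * (g q * (R * g q) * R) := by simp only [mul_assoc]
      _ = T u 0 * (g q * g q) * headProd u (Fin.last m).castSucc * R := by
          rw [h2]; simp only [mul_assoc]
      _ = g q * g q * (T u (Fin.last m) * headProd u (Fin.last m).castSucc) * R := by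
          rw [← h5]; simp only [mul_assoc]
      _ = g q * g q * (headProd u (Fin.last m).castSucc * tailProd u 0) := by
          rw [h4, h3]; simp only [mul_assoc]
      _ = g q * (R * g q) * tailProd u 0 := by rw [h2]; simp only [mul_assoc]
      _ = g q * R * (g q * tailProd u 0) := by simp only [mul_assoc]
  have hY1 : Y q u (Fin.succ (0 : Fin (m + 1))) = Tinv u 0 * (g q * R) := by
    rw [Y_succ hu, Fin.castSucc_zero, Y_zero_eq, h1]
    simp only [mul_assoc]
    rw [T_mul_Tinv hu, mul_one]
  have h7 : Tinv u 0 * (g q * R * (g q * tailProd u 0)) = g q * R * g q * R := by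
    rw [← h6, ← mul_assoc, Tinv_mul_T hu, one_mul]
  rw [commute_iff_eq, hY1, Y_zero_eq, mul_assoc (Tinv u 0), h7, h1]
  calc g q * (R * T u 0) * (Tinv u 0 * (g q * R)) =
        g q * R * (T u 0 * Tinv u 0) * (g q * R) := by simp only [mul_assoc]
    _ = g q * R * g q * R := by rw [T_mul_Tinv hu]; simp only [mul_assoc, one_mul]

theorem commute_Y_zero {q u : ℂ} (hq : q ≠ 0) (hu : u ≠ 0) (k : Fin (m + 1)) :
    Commute (Y q u 0) (Y q u k) := by
  induction k using Fin.induction with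
  | zero => exact Commute.refl _
  | succ k ih =>
    by_cases hk : (k : ℕ) = 0
    · obtain _ | m := m
      · exact k.elim0
      · obtain rfl : k = 0 := Fin.ext hk
        exact commute_Y_zero_Y_one hq hu
    · have hc := commute_Tinv (commute_T_Y_of_lt hq hu (q := q) k 0 (by simp; omega)).symm
      rw [Y_succ hu]
      exact (hc.mul_right ih).mul_right hc

theorem commute_Y {q u : ℂ} (hq : q ≠ 0) (hu : u ≠ 0) (k l : Fin (m + 1)) :
    Commute (Y q u k) (Y q u l) := by
  wlog hkl : k ≤ l generalizing k l
  · exact (this l k (le_of_not_ge hkl)).symm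
  induction k using Fin.induction with
  | zero => exact commute_Y_zero hq hu l
  | succ k ih =>
    rcases hkl.eq_or_lt with e | h
    · rw [e]
    · have h' : (k : ℕ) + 2 ≤ l := by
        have := Fin.lt_def.mp h; simp at this; omega
      have hc := commute_Tinv (commute_T_Y_of_gt hq hu (q := q) k l h').symm
      rw [Y_succ hu]
      refine ((hc.symm.mul_left (ih ?_)).mul_left hc.symm)
      rw [Fin.le_def]; simp; omega

/-! ### An ordering of the monomials -/

/-- The squared Euclidean length of an exponent. -/
def normSq (μ : Fin (m + 1) → ℤ) : ℤ := ∑ j, μ j ^ 2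

/-- The sum of the entries of an exponent, weighted by their positions. Within an orbit of the
symmetric group, it decreases when a larger entry is moved to the left. -/
def weight (μ : Fin (m + 1) → ℤ) : ℤ := ∑ j : Fin (m + 1), ((j : ℕ) : ℤ) * μ j

/-- The rank by which monomials are compared: first by `normSq`, then by `weight`. Distinct
exponents may have the same rank. -/
def rank (μ : Fin (m + 1) → ℤ) : ℤ ×ₗ ℤ := toLex (normSq μ, weight μ)

theorem rank_lt_iff {μ ν : Fin (m + 1) → ℤ} :
    rank ν < rank μ ↔ normSq ν < normSq μ ∨ normSq ν = normSq μ ∧ weight ν < weight μ :=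
  Prod.Lex.toLex_lt_toLex

theorem normSq_act (z : Equiv.Perm (Fin (m + 1))) (μ : Fin (m + 1) → ℤ) :
    normSq (act z μ) = normSq μ :=
  Equiv.sum_comp z⁻¹ fun j => μ j ^ 2

theorem sum_act_swap (c : Fin (m + 1) → ℤ) {i j : Fin (m + 1)} (hij : i ≠ j)
    (μ : Fin (m + 1) → ℤ) :
    ∑ l, c l * act (Equiv.swap i j) μ l = ∑ l, c l * μ l - (c j - c i) * (μ j - μ i) := by
  have h : ∑ l, (c l * μ l - c l * act (Equiv.swap i j) μ l) = (c j - c i) * (μ j - μ i) := by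
    rw [Finset.sum_eq_add_of_mem i j (Finset.mem_univ _) (Finset.mem_univ _) hij]
    · simp [act]; ring
    · rintro l - ⟨h1, h2⟩
      simp [act, Equiv.swap_apply_of_ne_of_ne h1 h2]
  rw [Finset.sum_sub_distrib] at h
  linarith

theorem rank_act_swap_lt {i j : Fin (m + 1)} {μ : Fin (m + 1) → ℤ} (hij : i < j)
    (hμ : μ i < μ j) : rank (act (Equiv.swap i j) μ) < rank μ := by
  refine rank_lt_iff.mpr (Or.inr ⟨normSq_act _ _, ?_⟩)
  rw [weight, weight, sum_act_swap _ hij.ne]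
  have h1 : (0 : ℤ) < ((j : ℕ) : ℤ) - ((i : ℕ) : ℤ) := by
    have := Fin.lt_def.mp hij; omega
  have h2 : 0 < μ j - μ i := by omega
  nlinarith [mul_pos h1 h2]

theorem finite_setOf_rank_lt (μ : Fin (m + 1) → ℤ) :
    {ν : Fin (m + 1) → ℤ | rank ν < rank μ}.Finite := by
  refine (Set.Finite.pi' (ι := Fin (m + 1))
    fun _ => Set.finite_Icc (-normSq μ) (normSq μ)).subset ?_
  intro ν hν j
  have h1 : normSq ν ≤ normSq μ := by
    rcases rank_lt_iff.mp hν with h | h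
    · exact h.le
    · exact h.1.le
  have h2 : ν j ^ 2 ≤ normSq ν :=
    Finset.single_le_sum (f := fun j => ν j ^ 2) (fun _ _ => sq_nonneg _) (Finset.mem_univ j)
  have h3 : ν j ≤ ν j ^ 2 := Int.le_self_sq _
  have h4 : -ν j ≤ ν j ^ 2 := by
    have := Int.le_self_sq (-ν j); rwa [neg_sq] at this
  exact ⟨by linarith, by linarith⟩

/-- The Laurent polynomials whose exponents all lie in `S`. -/
def supportedOn (S : Set (Fin (m + 1) → ℤ)) : Submodule ℂ (Laurent m) where
  carrier := {h | ∀ ν, h.coeff ν ≠ 0 → ν ∈ S}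
  zero_mem' := by intro ν h; simp at h
  add_mem' := by
    intro a b ha hb ν h
    by_contra hν
    have h1 : a.coeff ν = 0 := by by_contra h'; exact hν (ha ν h')
    have h2 : b.coeff ν = 0 := by by_contra h'; exact hν (hb ν h')
    exact h (by simp [AddMonoidAlgebra.coeff_add, h1, h2])
  smul_mem' := by
    intro c a ha ν h
    refine ha ν fun h' => h (by simp [h'])

theorem coeff_eq_zero_of_notMem {S : Set (Fin (m + 1) → ℤ)} {h : Laurent m}
    (hh : h ∈ supportedOn S) {ν : Fin (m + 1) → ℤ} (hν : ν ∉ S) : h.coeff ν = 0 := by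
  by_contra h'; exact hν (hh ν h')

theorem coeff_mono (μ ν : Fin (m + 1) → ℤ) :
    (mono μ : Laurent m).coeff ν = if μ = ν then 1 else 0 := by
  classical
  simp [mono, Finsupp.single_apply]

theorem mono_mem_supportedOn {S : Set (Fin (m + 1) → ℤ)} {μ : Fin (m + 1) → ℤ} (h : μ ∈ S) :
    mono μ ∈ supportedOn S := by
  intro ν hν
  rw [coeff_mono] at hν
  split_ifs at hν with e
  · rwa [← e]
  · exact absurd rfl hν

theorem supportedOn_mono {S S' : Set (Fin (m + 1) → ℤ)} (h : S ⊆ S') :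
    supportedOn S ≤ supportedOn S' := fun _ hh ν hν => h (hh ν hν)

theorem eq_sum_mono (h : Laurent m) : h = ∑ ν ∈ h.coeff.support, h.coeff ν • mono ν := by
  conv_lhs => rw [← AddMonoidAlgebra.sum_coeff_single h]
  refine Finset.sum_congr rfl fun ν _ => ?_
  simp [mono]

theorem map_mem_of_mem_supportedOn {A : Module.End ℂ (Laurent m)} {S : Set (Fin (m + 1) → ℤ)}
    {P : Submodule ℂ (Laurent m)} (hA : ∀ ν ∈ S, A (mono ν) ∈ P) {h : Laurent m}
    (hh : h ∈ supportedOn S) : A h ∈ P := by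
  rw [eq_sum_mono h, map_sum]
  refine Submodule.sum_mem _ fun ν hν => ?_
  rw [map_smul]
  exact P.smul_mem _ (hA ν (hh ν (Finsupp.mem_support_iff.mp hν)))

/-- The span of the monomials of rank less than that of `μ`. -/
def lower (μ : Fin (m + 1) → ℤ) : Submodule ℂ (Laurent m) := supportedOn {ν | rank ν < rank μ}

/-- The span of the monomials with exponents of squared length less than `c`. -/
def shorter (c : ℤ) : Submodule ℂ (Laurent m) := supportedOn {ν | normSq ν < c}

theorem shorter_le_lower (μ : Fin (m + 1) → ℤ) : shorter (normSq μ) ≤ lower μ :=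
  supportedOn_mono fun _ h => rank_lt_iff.mpr (Or.inl h)

theorem permOp_mem_shorter (z : Equiv.Perm (Fin (m + 1))) {c : ℤ} {h : Laurent m}
    (hh : h ∈ shorter c) : permOp z h ∈ shorter c := by
  refine map_mem_of_mem_supportedOn (fun ν hν => ?_) hh
  rw [permOp_mono]
  refine mono_mem_supportedOn ?_
  simpa only [Set.mem_ofPred_eq, normSq_act] using hν

/-- The operator `A` is triangular with respect to the rank, with diagonal entries `d`. -/
def IsTriangular (A : Module.End ℂ (Laurent m)) (d : (Fin (m + 1) → ℤ) → ℂ) : Prop :=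
  ∀ μ, A (mono μ) - d μ • mono μ ∈ lower μ

theorem IsTriangular.map_lower {A : Module.End ℂ (Laurent m)} {d : (Fin (m + 1) → ℤ) → ℂ}
    (hA : IsTriangular A d) {μ : Fin (m + 1) → ℤ} {h : Laurent m} (hh : h ∈ lower μ) :
    A h ∈ lower μ := by
  refine map_mem_of_mem_supportedOn (fun ν hν => ?_) hh
  rw [← sub_add_cancel (A (mono ν)) (d ν • mono ν)]
  refine Submodule.add_mem _ ?_ (Submodule.smul_mem _ _ (mono_mem_supportedOn hν))
  have hsub : {κ : Fin (m + 1) → ℤ | rank κ < rank ν} ⊆ {κ | rank κ < rank μ} :=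
    fun κ hκ => show rank κ < rank μ from
      lt_trans (show rank κ < rank ν from hκ) (show rank ν < rank μ from hν)
  exact supportedOn_mono hsub (hA ν)

theorem IsTriangular.mul {A B : Module.End ℂ (Laurent m)} {d e : (Fin (m + 1) → ℤ) → ℂ}
    (hA : IsTriangular A d) (hB : IsTriangular B e) :
    IsTriangular (A * B) fun μ => d μ * e μ := by
  intro μ
  have : (A * B) (mono μ) - (d μ * e μ) • mono μ =
      A (B (mono μ) - e μ • mono μ) + e μ • (A (mono μ) - d μ • mono μ) := by
    rw [Module.End.mul_apply, map_sub, map_smul, smul_sub, smul_smul, mul_comm (d μ)]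
    abel
  rw [this]
  exact Submodule.add_mem _ (hA.map_lower (hB μ)) (Submodule.smul_mem _ _ (hA μ))

theorem IsTriangular.one : IsTriangular (1 : Module.End ℂ (Laurent m)) fun _ => 1 := by
  intro μ
  simp

/-! ### The action of the Demazure-Lusztig operators on monomials -/

theorem normSq_setPair (i : Fin m) (μ : Fin (m + 1) → ℤ) (a b : ℤ) :
    normSq (setPair i μ a b) = normSq μ - μ i.castSucc ^ 2 - μ i.succ ^ 2 + a ^ 2 + b ^ 2 := by
  have hne : i.castSucc ≠ i.succ := Fin.castSucc_lt_succ.ne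
  have h : ∑ l, (setPair i μ a b l ^ 2 - μ l ^ 2) =
      (a ^ 2 - μ i.castSucc ^ 2) + (b ^ 2 - μ i.succ ^ 2) := by
    rw [Finset.sum_eq_add_of_mem i.castSucc i.succ (Finset.mem_univ _) (Finset.mem_univ _) hne]
    · simp [setPair, hne]
    · rintro l - ⟨h1, h2⟩
      simp [setPair, h1, h2]
  rw [Finset.sum_sub_distrib] at h
  rw [normSq, normSq]
  linarith

theorem var_castSucc_mul_setPair (i : Fin m) (μ : Fin (m + 1) → ℤ) (a b : ℤ) :
    var i.castSucc * mono (setPair i μ a b) = mono (setPair i μ (a + 1) b) := by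
  have hne : i.castSucc ≠ i.succ := Fin.castSucc_lt_succ.ne
  rw [var, mono_mul]
  congr 1
  funext j
  by_cases h1 : j = i.succ
  · subst h1; simp [setPair, hne.symm]
  · by_cases h2 : j = i.castSucc
    · subst h2; simp [setPair, hne, add_comm]
    · simp [setPair, h1, h2]

theorem var_succ_mul_setPair (i : Fin m) (μ : Fin (m + 1) → ℤ) (a b : ℤ) :
    var i.succ * mono (setPair i μ a b) = mono (setPair i μ a (b + 1)) := by
  have hne : i.castSucc ≠ i.succ := Fin.castSucc_lt_succ.ne
  rw [var, mono_mul]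
  congr 1
  funext j
  by_cases h1 : j = i.succ
  · subst h1; simp [setPair, add_comm]
  · by_cases h2 : j = i.castSucc
    · subst h2; simp [setPair, hne]
    · simp [setPair, h1, h2]

theorem act_s_eq_self {i : Fin m} {μ : Fin (m + 1) → ℤ} (h : μ i.castSucc = μ i.succ) :
    act (s i) μ = μ := by
  rw [← setPair_swap, ← h]
  nth_rewrite 2 [h]
  exact setPair_self i μ

theorem DL_mono_of_eq (t : ℂ) {i : Fin m} {μ : Fin (m + 1) → ℤ} (h : μ i.castSucc = μ i.succ) :
    DL t i (mono μ) = t • mono μ := by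
  rw [DL_apply, divDiff, linOp_mono, h]
  simp

theorem DL_mono_of_gt (t : ℂ) {i : Fin m} {μ : Fin (m + 1) → ℤ} (h : μ i.succ < μ i.castSucc) :
    DL t i (mono μ) - mono (act (s i) μ) ∈ shorter (normSq μ) := by
  obtain ⟨N, hN⟩ : ∃ N : ℕ, μ i.castSucc = μ i.succ + (N + 1) :=
    ⟨(μ i.castSucc - μ i.succ - 1).toNat, by omega⟩
  have e1 : (μ i.castSucc - μ i.succ).toNat = N + 1 := by omega
  have e2 : (μ i.succ - μ i.castSucc).toNat = 0 := by omega
  -- The geometric sum of `divDiff`, multiplied by each of the two variables, gives the same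
  -- strictly intermediate monomials; the two extreme ones are `mono μ` and its image under `sᵢ`.
  have hd : DL t i (mono μ) = mono (act (s i) μ) + ∑ k ∈ Finset.range N,
      (1 - t) • mono (setPair i μ (μ i.castSucc - 1 - k) (μ i.succ + 1 + k)) := by
    rw [DL_apply, divDiff, linOp_mono, e1, e2, Finset.sum_range_zero, sub_zero, sub_mul,
      smul_mul_assoc, Finset.mul_sum, Finset.mul_sum]
    simp only [var_castSucc_mul_setPair, var_succ_mul_setPair]
    rw [Finset.sum_range_succ', Finset.sum_range_succ]
    have h1 : μ i.castSucc - 1 - ((0 : ℕ) : ℤ) + 1 = μ i.castSucc := by push_cast; ring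
    have h2 : μ i.succ + ((0 : ℕ) : ℤ) = μ i.succ := by push_cast; ring
    have h3 : μ i.castSucc - 1 - (N : ℤ) = μ i.succ := by omega
    have h4 : μ i.succ + (N : ℤ) + 1 = μ i.castSucc := by omega
    rw [h1, h2, h3, h4, setPair_self, setPair_swap]
    have h5 : ∀ k : ℕ, mono (setPair i μ (μ i.castSucc - 1 - ((k + 1 : ℕ) : ℤ) + 1)
        (μ i.succ + ((k + 1 : ℕ) : ℤ))) =
        (mono (setPair i μ (μ i.castSucc - 1 - k) (μ i.succ + 1 + k)) : Laurent m) := by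
      intro k; congr 2 <;> push_cast <;> ring
    have h6 : ∀ k : ℕ, mono (setPair i μ (μ i.castSucc - 1 - k) (μ i.succ + k + 1)) =
        (mono (setPair i μ (μ i.castSucc - 1 - k) (μ i.succ + 1 + k)) : Laurent m) := by
      intro k; congr 2; ring
    simp only [h5, h6, sub_smul, one_smul, Finset.sum_sub_distrib, ← Finset.smul_sum, smul_add]
    abel
  rw [hd, add_sub_cancel_left]
  refine Submodule.sum_mem _ fun k hk => Submodule.smul_mem _ _ (mono_mem_supportedOn ?_)
  rw [Set.mem_ofPred_eq, normSq_setPair]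
  have hk' : (k : ℤ) < N := by exact_mod_cast Finset.mem_range.mp hk
  rw [hN]
  nlinarith [mul_pos (show (0 : ℤ) < k + 1 by positivity) (show (0 : ℤ) < N - k by linarith)]

theorem act_s_apply_castSucc (i : Fin m) (μ : Fin (m + 1) → ℤ) :
    act (s i) μ i.castSucc = μ i.succ := by
  simp only [act, s_inv, s_castSucc]

theorem act_s_apply_succ (i : Fin m) (μ : Fin (m + 1) → ℤ) :
    act (s i) μ i.succ = μ i.castSucc := by
  simp only [act, s_inv, s_succ]

theorem act_s_act_s (i : Fin m) (μ : Fin (m + 1) → ℤ) : act (s i) (act (s i) μ) = μ := by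
  rw [← act_mul, s_mul_s, act_one]

theorem DL_mono_of_lt (t : ℂ) {i : Fin m} {μ : Fin (m + 1) → ℤ} (h : μ i.castSucc < μ i.succ) :
    DL t i (mono μ) - ((t - 1) • mono μ + t • mono (act (s i) μ)) ∈ shorter (normSq μ) := by
  have h1 := DL_mono_of_gt t (i := i) (μ := act (s i) μ)
    (by rwa [act_s_apply_castSucc, act_s_apply_succ])
  rw [act_s_act_s, normSq_act] at h1
  have h2 := DL_apply_permOp t i (mono (act (s i) μ))
  rw [permOp_mono, act_s_act_s] at h2
  rw [h2, ← Submodule.neg_mem_iff]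
  convert h1 using 1
  rw [sub_smul, one_smul]
  abel

/-! ### Triangularity of the Cherednik-Dunkl operators -/

/-- The strict total order on positions that underlies the stable sorting of `μ`: position `a`
precedes position `b` if its entry is smaller, or equal and further to the left. -/
def Precedes (μ : Fin (m + 1) → ℤ) (a b : Fin (m + 1)) : Prop :=
  μ a < μ b ∨ μ a = μ b ∧ a < b

instance (μ : Fin (m + 1) → ℤ) (a b : Fin (m + 1)) : Decidable (Precedes μ a b) := by
  unfold Precedes; infer_instance

/-- The factor picked up when the entry from position `i` is moved past the one from position
`j`. -/
def crossing (u : ℂ) (μ : Fin (m + 1) → ℤ) (i j : Fin (m + 1)) : ℂ :=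
  if Precedes μ j i then u⁻¹ else u

theorem s_mul_inv_apply_castSucc (k : Fin m) (p : Equiv.Perm (Fin (m + 1))) :
    (s k * p)⁻¹ k.castSucc = p⁻¹ k.succ := by
  rw [mul_inv_rev, s_inv, Equiv.Perm.mul_apply, s_castSucc]

theorem s_mul_inv_apply_succ (k : Fin m) (p : Equiv.Perm (Fin (m + 1))) :
    (s k * p)⁻¹ k.succ = p⁻¹ k.castSucc := by
  rw [mul_inv_rev, s_inv, Equiv.Perm.mul_apply, s_succ]

theorem permOp_inv_s_mul_mono (k : Fin m) (p : Equiv.Perm (Fin (m + 1))) (μ : Fin (m + 1) → ℤ) :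
    permOp (s k * p)⁻¹ (mono (act p μ)) =
      mono (act (Equiv.swap (p⁻¹ k.castSucc) (p⁻¹ k.succ)) μ) := by
  rw [permOp_mono, ← act_mul]
  congr 2
  rw [mul_inv_rev, s_inv, s, mul_assoc, Equiv.swap_mul_eq_mul_swap, inv_mul_cancel_left]

theorem permOp_mul_conj (A : Module.End ℂ (Laurent m)) (p p' : Equiv.Perm (Fin (m + 1))) :
    A * permOp p = permOp p' * (permOp p'⁻¹ * A * permOp p) := by
  rw [← mul_assoc, ← mul_assoc, ← permOp_mul, mul_inv_cancel, permOp_one, one_mul]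

/-- `Tₖ`, conjugated by permutations, is triangular if the entry it moves to the right has its home
position, given by `p⁻¹`, to the left of that of the entry it passes. -/
theorem isTriangular_T {u : ℂ} (hu : u ≠ 0) (k : Fin m) (p : Equiv.Perm (Fin (m + 1)))
    (hp : p⁻¹ k.castSucc < p⁻¹ k.succ) :
    IsTriangular (permOp (s k * p)⁻¹ * T u k * permOp p)
      fun μ => crossing u μ (p⁻¹ k.castSucc) (p⁻¹ k.succ) := by
  intro μ
  have hswap := permOp_inv_s_mul_mono k p μ
  have hid : permOp (s k * p)⁻¹ (mono (act (s k) (act p μ))) = mono μ := by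
    rw [permOp_mono, ← act_mul (s k), ← act_mul, inv_mul_cancel, act_one]
  have hlow : ∀ h ∈ shorter (normSq (act p μ)), permOp (s k * p)⁻¹ h ∈ lower μ := fun h hh =>
    shorter_le_lower μ (by rw [normSq_act] at hh; exact permOp_mem_shorter _ hh)
  simp only [Module.End.mul_apply, permOp_mono]
  rw [T_eq, LinearMap.smul_apply, map_smul, crossing]
  rcases lt_trichotomy (μ (p⁻¹ k.castSucc)) (μ (p⁻¹ k.succ)) with h | h | h
  · rw [if_neg (by rintro (h' | ⟨h', -⟩) <;> omega)]
    have h1 := hlow _ (DL_mono_of_lt (u ^ 2) (i := k) (μ := act p μ) h)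
    rw [map_sub, map_add, map_smul, map_smul, hid, hswap] at h1
    have h2 : mono (act (Equiv.swap (p⁻¹ k.castSucc) (p⁻¹ k.succ)) μ) ∈ lower μ :=
      mono_mem_supportedOn (rank_act_swap_lt hp h)
    convert Submodule.add_mem _ (Submodule.smul_mem _ u⁻¹ h1)
      (Submodule.smul_mem _ (u⁻¹ * (u ^ 2 - 1)) h2) using 1
    have h3 : u⁻¹ * u ^ 2 = u := by field_simp
    rw [smul_sub, smul_add, smul_smul, smul_smul, h3]
    abel
  · rw [if_neg (by rintro (h' | ⟨-, h'⟩); exacts [h'.ne' h, absurd hp h'.not_gt])]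
    have he : act p μ k.castSucc = act p μ k.succ := h
    rw [DL_mono_of_eq _ he, map_smul, ← act_s_eq_self he, hid, smul_smul]
    have h3 : u⁻¹ * u ^ 2 = u := by field_simp
    rw [h3, sub_self]
    exact Submodule.zero_mem _
  · rw [if_pos (show Precedes μ _ _ from Or.inl h)]
    have h1 := hlow _ (DL_mono_of_gt (u ^ 2) (i := k) (μ := act p μ) h)
    rw [map_sub, hid] at h1
    rw [← smul_sub]
    exact Submodule.smul_mem _ _ h1

/-- The counterpart of `isTriangular_T` for `Tₖ⁻¹`, under the opposite condition. -/
theorem isTriangular_Tinv {u : ℂ} (hu : u ≠ 0) (k : Fin m) (p : Equiv.Perm (Fin (m + 1)))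
    (hp : p⁻¹ k.succ < p⁻¹ k.castSucc) :
    IsTriangular (permOp (s k * p)⁻¹ * Tinv u k * permOp p)
      fun μ => crossing u μ (p⁻¹ k.castSucc) (p⁻¹ k.succ) := by
  intro μ
  have hswap := permOp_inv_s_mul_mono k p μ
  have hid : permOp (s k * p)⁻¹ (mono (act (s k) (act p μ))) = mono μ := by
    rw [permOp_mono, ← act_mul (s k), ← act_mul, inv_mul_cancel, act_one]
  have hlow : ∀ h ∈ shorter (normSq (act p μ)), permOp (s k * p)⁻¹ h ∈ lower μ := fun h hh =>
    shorter_le_lower μ (by rw [normSq_act] at hh; exact permOp_mem_shorter _ hh)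
  simp only [Module.End.mul_apply, permOp_mono]
  rw [Tinv, T_eq, LinearMap.sub_apply, LinearMap.smul_apply, LinearMap.smul_apply,
    Module.End.one_apply, map_sub, map_smul, map_smul, crossing]
  rcases lt_trichotomy (μ (p⁻¹ k.castSucc)) (μ (p⁻¹ k.succ)) with h | h | h
  · rw [if_neg (by rintro (h' | ⟨h', -⟩) <;> omega)]
    have h1 := hlow _ (DL_mono_of_lt (u ^ 2) (i := k) (μ := act p μ) h)
    rw [map_sub, map_add, map_smul, map_smul, hid] at h1
    convert Submodule.smul_mem _ u⁻¹ h1 using 1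
    have h3 : u⁻¹ * u ^ 2 = u := by field_simp
    have h4 : u⁻¹ * (u ^ 2 - 1) = u - u⁻¹ := by field_simp
    rw [smul_sub, smul_add, smul_smul, smul_smul, h3, h4]
    abel
  · rw [if_pos (show Precedes μ _ _ from Or.inr ⟨h.symm, hp⟩)]
    have he : act p μ k.castSucc = act p μ k.succ := h
    rw [DL_mono_of_eq _ he, map_smul, ← act_s_eq_self he, hid, smul_smul]
    have h3 : u⁻¹ * u ^ 2 = u := by field_simp
    rw [h3, ← sub_smul, ← sub_smul]
    simp
  · rw [if_pos (show Precedes μ _ _ from Or.inl h)]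
    have h1 := hlow _ (DL_mono_of_gt (u ^ 2) (i := k) (μ := act p μ) h)
    rw [map_sub, hid] at h1
    have h2 : mono (act (Equiv.swap (p⁻¹ k.castSucc) (p⁻¹ k.succ)) μ) ∈ lower μ := by
      rw [Equiv.swap_comm]
      exact mono_mem_supportedOn (rank_act_swap_lt hp h)
    rw [hswap]
    convert Submodule.sub_mem _ (Submodule.smul_mem _ u⁻¹ h1)
      (Submodule.smul_mem _ (u - u⁻¹) h2) using 1
    rw [smul_sub]
    abel

/-- The permutation `sₙ₋₁ ⋯ sₖ`, which moves position `k` to the end and keeps the order of the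
other positions. -/
def tailCycle : Fin (m + 1) → Equiv.Perm (Fin (m + 1)) :=
  Fin.reverseInduction 1 fun i c => c * s i

theorem tailCycle_last : tailCycle (Fin.last m) = 1 := by simp [tailCycle]

theorem tailCycle_castSucc (i : Fin m) : tailCycle i.castSucc = tailCycle i.succ * s i := by
  simp [tailCycle]

theorem partialProd_s_mul_tailCycle (k : Fin (m + 1)) :
    Fin.partialProd s (Fin.last m) * tailCycle k = Fin.partialProd s k := by
  induction k using Fin.reverseInduction with
  | last => rw [tailCycle_last, mul_one]
  | cast k ih =>
    rw [tailCycle_castSucc, ← mul_assoc, ih, Fin.partialProd_succ, mul_assoc, s_mul_s, mul_one]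

theorem partialProd_s_self (k : Fin (m + 1)) : Fin.partialProd s k k = 0 := by
  ext; rw [partialProd_s_apply]; simp

theorem tailCycle_self (k : Fin (m + 1)) : tailCycle k k = Fin.last m := by
  apply (Fin.partialProd s (Fin.last m)).injective
  rw [partialProd_s_self, ← Equiv.Perm.mul_apply, partialProd_s_mul_tailCycle, partialProd_s_self]

theorem partialProd_s_inv_succ {k : Fin (m + 1)} {j : Fin m} (h : (j : ℕ) < k) :
    (Fin.partialProd s k)⁻¹ j.succ = j.castSucc := by
  rw [Equiv.Perm.inv_eq_iff_eq]
  ext; rw [partialProd_s_apply]; simp [h]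

theorem partialProd_s_inv_zero (k : Fin (m + 1)) : (Fin.partialProd s k)⁻¹ 0 = k := by
  rw [Equiv.Perm.inv_eq_iff_eq, partialProd_s_self]

theorem tailProd_mul_permOp {u : ℂ} (hu : u ≠ 0) (k : Fin (m + 1)) (p : Equiv.Perm (Fin (m + 1)))
    (hp : ∀ j, k < j → p⁻¹ k < p⁻¹ j) :
    ∃ A, tailProd u k * permOp p = permOp (tailCycle k * p) * A ∧
      IsTriangular A fun μ => ∏ j ∈ Finset.Ioi k, crossing u μ (p⁻¹ k) (p⁻¹ j) := by
  induction k using Fin.reverseInduction generalizing p with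
  | last =>
    refine ⟨1, by simp [tailProd_last, tailCycle_last], ?_⟩
    have : Finset.Ioi (Fin.last m) = ∅ := by ext j; simp [Fin.le_last]
    simpa [this] using IsTriangular.one
  | cast k ih =>
    have hne : ∀ j, k.succ < j → (s k * p)⁻¹ j = p⁻¹ j := by
      intro j hj
      rw [mul_inv_rev, s_inv, Equiv.Perm.mul_apply,
        s_of_ne k (Fin.castSucc_lt_succ.trans hj).ne' hj.ne']
    obtain ⟨A, hA1, hA2⟩ := ih (s k * p) (by
      intro j hj
      rw [s_mul_inv_apply_succ, hne j hj]
      exact hp j (Fin.castSucc_lt_succ.trans hj))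
    refine ⟨A * (permOp (s k * p)⁻¹ * T u k * permOp p), ?_, ?_⟩
    · rw [tailProd_castSucc, mul_assoc, permOp_mul_conj (T u k) p (s k * p), ← mul_assoc, hA1,
        tailCycle_castSucc, mul_assoc, mul_assoc (tailCycle k.succ)]
    · convert hA2.mul (isTriangular_T hu k p (hp _ Fin.castSucc_lt_succ)) using 2 with μ
      have : Finset.Ioi k.castSucc = insert k.succ (Finset.Ioi k.succ) := by
        ext j
        simp only [Finset.mem_Ioi, Finset.mem_insert, Fin.lt_def, Fin.ext_iff, Fin.val_castSucc,
          Fin.val_succ]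
        omega
      rw [this, Finset.prod_insert (by simp), mul_comm, s_mul_inv_apply_succ]
      congr 1
      refine Finset.prod_congr rfl fun j hj => ?_
      rw [hne j (Finset.mem_Ioi.mp hj)]

theorem headInvProd_mul_permOp {u : ℂ} (hu : u ≠ 0) (k : Fin (m + 1))
    (p : Equiv.Perm (Fin (m + 1))) (hp : ∀ j, 0 < j → j ≤ k → p⁻¹ j < p⁻¹ 0) :
    ∃ A, headInvProd u k * permOp p = permOp ((Fin.partialProd s k)⁻¹ * p) * A ∧
      IsTriangular A fun μ => ∏ j ∈ Finset.Ioc 0 k, crossing u μ (p⁻¹ 0) (p⁻¹ j) := by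
  induction k using Fin.induction with
  | zero =>
    refine ⟨1, by simp [headInvProd_zero], ?_⟩
    simpa using IsTriangular.one
  | succ k ih =>
    obtain ⟨A, hA1, hA2⟩ := ih fun j h1 h2 => hp j h1 (h2.trans Fin.castSucc_lt_succ.le)
    set p' := (Fin.partialProd s k.castSucc)⁻¹ * p with hp'
    have e1 : p'⁻¹ k.castSucc = p⁻¹ 0 := by
      rw [hp', mul_inv_rev, inv_inv, Equiv.Perm.mul_apply, partialProd_s_self]
    have e2 : p'⁻¹ k.succ = p⁻¹ k.succ := by
      rw [hp', mul_inv_rev, inv_inv, Equiv.Perm.mul_apply]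
      congr 1
      ext; rw [partialProd_s_apply]; simp [Fin.ext_iff]
    have e3 : (Fin.partialProd s k.succ)⁻¹ * p = s k * p' := by
      rw [Fin.partialProd_succ, mul_inv_rev, s_inv, mul_assoc]
    refine ⟨(permOp (s k * p')⁻¹ * Tinv u k * permOp p') * A, ?_, ?_⟩
    · rw [headInvProd_succ, mul_assoc, hA1, ← mul_assoc, permOp_mul_conj (Tinv u k) p' (s k * p'),
        e3, mul_assoc]
    · convert (isTriangular_Tinv hu k p'
        (by rw [e1, e2]; exact hp _ (Fin.succ_pos k) le_rfl)).mul hA2 using 2 with μ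
      have : Finset.Ioc 0 k.succ = insert k.succ (Finset.Ioc 0 k.castSucc) := by
        ext j
        simp only [Finset.mem_Ioc, Finset.mem_insert, Fin.lt_def, Fin.le_def, Fin.ext_iff,
          Fin.val_castSucc, Fin.val_succ, Fin.val_zero]
        omega
      rw [this, Finset.prod_insert (by simp), e1, e2]

theorem g_mul_permOp (q : ℂ) (p : Equiv.Perm (Fin (m + 1))) :
    ∃ A, g q * permOp p = permOp (Fin.partialProd s (Fin.last m) * p) * A ∧
      IsTriangular A fun μ => q ^ (-μ (p⁻¹ (Fin.last m))) := by
  refine ⟨linOp fun μ => q ^ (-μ (p⁻¹ (Fin.last m))) • mono μ, end_ext fun μ => ?_, fun μ => ?_⟩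
  · rw [Module.End.mul_apply, Module.End.mul_apply, permOp_mono, g_mono, linOp_mono, map_smul,
      permOp_mono, act_mul, act_partialProd_s_last]
    rfl
  · rw [linOp_mono, sub_self]
    exact Submodule.zero_mem _

/-- The position of `k` in the stable sorting of `μ`, counted from `0`. -/
def position (μ : Fin (m + 1) → ℤ) (k : Fin (m + 1)) : ℕ :=
  (Finset.univ.filter fun j => Precedes μ j k).card

theorem prod_crossing {u : ℂ} (hu : u ≠ 0) (μ : Fin (m + 1) → ℤ) (k : Fin (m + 1)) :
    (∏ j ∈ Finset.Iio k, crossing u μ k j) * ∏ j ∈ Finset.Ioi k, crossing u μ k j =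
      u ^ (-2 * (position μ k : ℤ) + (m : ℤ)) := by
  have hd : Disjoint (Finset.Iio k) (Finset.Ioi k) := by
    rw [Finset.disjoint_left]
    intro a h1 h2
    exact absurd (Finset.mem_Iio.mp h1) (Finset.mem_Ioi.mp h2).not_gt
  have hU : Finset.Iio k ∪ Finset.Ioi k = Finset.univ.erase k := by
    ext a; simp [lt_or_lt_iff_ne]
  have hc : ∀ j, crossing u μ k j = u ^ (1 - 2 * (if Precedes μ j k then 1 else 0) : ℤ) := by
    intro j
    rw [crossing]
    split_ifs <;> simp
  rw [← Finset.prod_union hd, hU, Finset.prod_congr rfl fun j _ => hc j]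
  have hz : ∀ (S : Finset (Fin (m + 1))) (e : Fin (m + 1) → ℤ),
      ∏ j ∈ S, u ^ e j = u ^ ∑ j ∈ S, e j := by
    intro S e
    classical
    induction S using Finset.induction_on with
    | empty => simp
    | insert a S ha ih => rw [Finset.prod_insert ha, Finset.sum_insert ha, zpow_add₀ hu, ih]
  rw [hz]
  congr 1
  have hk : (if Precedes μ k k then 1 else 0 : ℤ) = 0 := if_neg (by simp [Precedes])
  rw [Finset.sum_sub_distrib, ← Finset.mul_sum, Finset.sum_erase (f := fun j =>
    (if Precedes μ j k then 1 else 0 : ℤ)) _ hk, position, Finset.card_filter]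
  simp
  ring

/-- The diagonal entry of `Yₖ` at the monomial with exponent `μ`. -/
def eigenvalue (q u : ℂ) (μ : Fin (m + 1) → ℤ) (k : Fin (m + 1)) : ℂ :=
  q ^ (-μ k) * u ^ (-2 * (position μ k : ℤ) + (m : ℤ))

/-- In `Yₖ = (Tₖ₋₁⁻¹ ⋯ T₁⁻¹) g (Tₙ₋₁ ⋯ Tₖ)` the entry at position `k` is moved to the right end,
then to the left end, and back to its place, past each other entry exactly once. -/
theorem isTriangular_Y {q u : ℂ} (hu : u ≠ 0) (k : Fin (m + 1)) :
    IsTriangular (Y q u k) fun μ => eigenvalue q u μ k := by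
  obtain ⟨A, hA1, hA2⟩ := tailProd_mul_permOp hu k 1 (by simp)
  obtain ⟨B, hB1, hB2⟩ := g_mul_permOp q (tailCycle k)
  obtain ⟨C, hC1, hC2⟩ := headInvProd_mul_permOp hu k (Fin.partialProd s k) (by
    intro j h1 h2
    obtain ⟨j, rfl⟩ := Fin.exists_succ_eq.mpr h1.ne'
    have h3 : (j : ℕ) < k := by have := Fin.le_def.mp h2; simp at this; omega
    rw [partialProd_s_inv_succ h3, partialProd_s_inv_zero, Fin.lt_def]
    exact h3)
  have hY : Y q u k = C * (B * A) := by
    rw [permOp_one, mul_one, mul_one] at hA1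
    rw [partialProd_s_mul_tailCycle] at hB1
    rw [inv_mul_cancel, permOp_one, one_mul] at hC1
    rw [Y_eq hu, hA1, mul_assoc, ← mul_assoc (g q), hB1, ← hC1]
    simp only [mul_assoc]
  rw [hY]
  convert hC2.mul (hB2.mul hA2) using 2 with μ
  have h1 : (tailCycle k)⁻¹ (Fin.last m) = k := by
    rw [Equiv.Perm.inv_eq_iff_eq, tailCycle_self]
  have h2 : ∏ j ∈ Finset.Ioc 0 k, crossing u μ ((Fin.partialProd s k)⁻¹ 0)
      ((Fin.partialProd s k)⁻¹ j) = ∏ j ∈ Finset.Iio k, crossing u μ k j := by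
    rw [partialProd_s_inv_zero]
    refine Finset.prod_equiv (Fin.partialProd s k)⁻¹ (fun j => ?_) fun _ _ => rfl
    induction j using Fin.cases with
    | zero => rw [partialProd_s_inv_zero]; simp
    | succ j =>
      by_cases h : (j : ℕ) < k
      · rw [partialProd_s_inv_succ h]
        simp only [Finset.mem_Ioc, Finset.mem_Iio, Fin.lt_def, Fin.le_def, Fin.val_succ,
          Fin.val_castSucc, Fin.val_zero]
        omega
      · have : (Fin.partialProd s k)⁻¹ j.succ = j.succ := by
          rw [Equiv.Perm.inv_eq_iff_eq]
          ext; rw [partialProd_s_apply]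
          simp only [Fin.ext_iff, Fin.val_succ]
          split_ifs <;> omega
        rw [this]
        simp only [Finset.mem_Ioc, Finset.mem_Iio, Fin.lt_def, Fin.le_def, Fin.val_succ,
          Fin.val_zero]
        omega
  rw [h2, h1, eigenvalue, ← prod_crossing hu]
  simp only [inv_one, Equiv.Perm.one_apply]
  ring

/-! ### Permutations of minimal length -/

theorem precedes_asymm {μ : Fin (m + 1) → ℤ} {a b : Fin (m + 1)} (h : Precedes μ a b) :
    ¬ Precedes μ b a := by
  rintro (h' | ⟨h', h''⟩) <;> rcases h with h | ⟨h, h3⟩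
  · omega
  · omega
  · omega
  · exact absurd h3 h''.not_gt

theorem precedes_irrefl (μ : Fin (m + 1) → ℤ) (a : Fin (m + 1)) : ¬ Precedes μ a a :=
  fun h => precedes_asymm h h

theorem precedes_trichotomy (μ : Fin (m + 1) → ℤ) (a b : Fin (m + 1)) :
    Precedes μ a b ∨ a = b ∨ Precedes μ b a := by
  rcases lt_trichotomy (μ a) (μ b) with h | h | h
  · exact Or.inl (Or.inl h)
  · rcases lt_trichotomy a b with h' | h' | h'
    · exact Or.inl (Or.inr ⟨h, h'⟩)
    · exact Or.inr (Or.inl h')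
    · exact Or.inr (Or.inr (Or.inr ⟨h.symm, h'⟩))
  · exact Or.inr (Or.inr (Or.inl h))

/-- The permutation `v` sends each position to its place in the stable sorting of `μ` into weakly
increasing order. -/
def IsStableSort (μ : Fin (m + 1) → ℤ) (v : Equiv.Perm (Fin (m + 1))) : Prop :=
  ∀ a b, v a < v b ↔ Precedes μ a b

theorem isStableSort_of_imp {μ : Fin (m + 1) → ℤ} {v : Equiv.Perm (Fin (m + 1))}
    (h : ∀ a b, Precedes μ a b → v a < v b) : IsStableSort μ v := by
  refine fun a b => ⟨fun hab => ?_, h a b⟩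
  rcases precedes_trichotomy μ a b with h' | h' | h'
  · exact h'
  · exact absurd hab (by simp [h'])
  · exact absurd hab (h _ _ h').not_gt

theorem IsStableSort.val_eq {μ : Fin (m + 1) → ℤ} {v : Equiv.Perm (Fin (m + 1))}
    (h : IsStableSort μ v) (a : Fin (m + 1)) : (v a : ℕ) = position μ a := by
  have h1 : position μ a = (Finset.univ.filter fun j => v j < v a).card := by
    rw [position]
    congr 1
    ext j
    simp [h j a]
  have h2 : (Finset.univ.filter fun j => v j < v a).card = (Finset.Iio (v a)).card := by
    refine Finset.card_bij (fun j _ => v j) (by simp) (by simp) fun b hb => ?_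
    exact ⟨v⁻¹ b, by simpa using hb, by simp⟩
  rw [h1, h2, Fin.card_Iio]

theorem IsStableSort.unique {μ : Fin (m + 1) → ℤ} {v w : Equiv.Perm (Fin (m + 1))}
    (hv : IsStableSort μ v) (hw : IsStableSort μ w) : v = w := by
  ext a
  rw [hv.val_eq, hw.val_eq]

theorem exists_isStableSort (μ : Fin (m + 1) → ℤ) :
    ∃ v, IsStableSort μ v ∧ Monotone (act v μ) := by
  obtain ⟨h1, h2⟩ := Tuple.eq_sort_iff.mp (rfl : Tuple.sort μ = Tuple.sort μ)
  refine ⟨(Tuple.sort μ)⁻¹, isStableSort_of_imp fun a b hab => ?_, ?_⟩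
  · by_contra hlt
    have ha : Tuple.sort μ ((Tuple.sort μ)⁻¹ a) = a := by simp
    have hb : Tuple.sort μ ((Tuple.sort μ)⁻¹ b) = b := by simp
    rcases (not_lt.mp hlt).eq_or_lt with e | hlt
    · exact precedes_irrefl μ a (by rwa [(Equiv.injective _ e : b = a)] at hab)
    · have h3 : μ b ≤ μ a := by simpa [ha, hb] using h1 hlt.le
      rcases h3.eq_or_lt with e | h3
      · have h4 := h2 _ _ hlt (by rw [ha, hb, e])
        rw [ha, hb] at h4
        exact precedes_asymm hab (Or.inr ⟨e, h4⟩)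
      · exact precedes_asymm hab (Or.inl h3)
  · have h : act (Tuple.sort μ)⁻¹ μ = μ ∘ Tuple.sort μ := by
      funext j; simp [act]
    rw [h]
    exact h1

/-- The inversions `a < b`, `μ b < μ a` are shared by all permutations that sort `μ`, and the
stable sorting has no others. -/
theorem isStableSort_of_isMinLength {μ : Fin (m + 1) → ℤ} {v : Equiv.Perm (Fin (m + 1))}
    (h : IsMinLength (fun v => Monotone (act v μ)) v) : IsStableSort μ v := by
  obtain ⟨w, hw, hwm⟩ := exists_isStableSort μ
  have hsort : ∀ a b, μ b < μ a → v b < v a := by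
    intro a b hab
    by_contra hlt
    have h1 : act v μ (v a) ≤ act v μ (v b) := h.1 (not_lt.mp hlt)
    rw [act_apply_apply, act_apply_apply] at h1
    omega
  have hsub : inversions w ⊆ inversions v := by
    rintro ⟨a, b⟩ hab
    rw [mem_inversions, hw b a] at hab
    rw [mem_inversions]
    refine ⟨hab.1, hsort a b ?_⟩
    rcases hab.2 with h' | h'
    · exact h'
    · exact absurd hab.1 h'.2.not_gt
  have heq := Finset.eq_of_subset_of_card_le hsub (h.2 w hwm)
  refine isStableSort_of_imp fun a b hab => ?_
  rcases hab with h' | ⟨h1, h2⟩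
  · exact hsort b a h'
  · by_contra hlt
    have h3 : v b < v a := lt_of_le_of_ne (not_lt.mp hlt) fun e => h2.ne' (v.injective e)
    have h4 : (a, b) ∈ inversions w := by rw [heq, mem_inversions]; exact ⟨h2, h3⟩
    rw [mem_inversions, hw b a] at h4
    exact precedes_asymm (Or.inr ⟨h1, h2⟩) h4.2

theorem isStableSort_vPerm (μ : Fin (m + 1) → ℤ) : IsStableSort μ (vPerm μ) :=
  isStableSort_of_isMinLength (exists_isMinLength (exists_act_monotone μ)).choose_spec

theorem length_inv (z : Equiv.Perm (Fin (m + 1))) : length z⁻¹ = length z := by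
  refine Finset.card_bij (fun p _ => (z⁻¹ p.2, z⁻¹ p.1)) ?_ ?_ ?_
  · rintro ⟨a, b⟩ h
    rw [mem_inversions] at h
    have ha : z (z⁻¹ a) = a := by simp
    have hb : z (z⁻¹ b) = b := by simp
    rw [mem_inversions, ha, hb]
    exact ⟨h.2, h.1⟩
  · rintro ⟨a, b⟩ _ ⟨c, d⟩ _ h
    simp only [Prod.mk.injEq, EmbeddingLike.apply_eq_iff_eq] at h
    rw [h.1, h.2]
  · rintro ⟨a, b⟩ h
    rw [mem_inversions] at h
    exact ⟨(z b, z a), by simpa [mem_inversions] using ⟨h.2, h.1⟩, by simp⟩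

theorem act_inv_act (z : Equiv.Perm (Fin (m + 1))) (μ : Fin (m + 1) → ℤ) :
    act z⁻¹ (act z μ) = μ := by
  rw [← act_mul, inv_mul_cancel, act_one]

theorem act_zPerm_decr (μ : Fin (m + 1) → ℤ) : act (zPerm μ) (decr μ) = μ :=
  (exists_isMinLength (exists_act_decr μ)).choose_spec.1

theorem eq_decr_of_antitone {μ : Fin (m + 1) → ℤ} {y : Equiv.Perm (Fin (m + 1))}
    (h : Antitone (act y μ)) : act y μ = decr μ := by
  have h1 : act y μ = μ ∘ (y⁻¹ : Equiv.Perm (Fin (m + 1))) := rfl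
  have h2 : decr μ = μ ∘ (Fin.revPerm.trans (Tuple.sort μ) : Equiv.Perm (Fin (m + 1))) := by
    funext j; simp [decr]
  rw [h1] at h ⊢
  rw [h2]
  exact Tuple.unique_antitone h (by rw [← h2]; exact antitone_decr μ)

/-- The inverse of `z_μ` is the stable sorting of `μ` into weakly decreasing order. -/
theorem isStableSort_zPerm_inv (μ : Fin (m + 1) → ℤ) : IsStableSort (-μ) (zPerm μ)⁻¹ := by
  have hz : IsMinLength (fun z => act z (decr μ) = μ) (zPerm μ) :=
    (exists_isMinLength (exists_act_decr μ)).choose_spec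
  have hneg : ∀ y : Equiv.Perm (Fin (m + 1)), act y (-μ) = -act y μ := fun _ => rfl
  refine isStableSort_of_isMinLength ⟨?_, fun y hy => ?_⟩
  · have h : act (zPerm μ)⁻¹ μ = decr μ := by
      conv_lhs => rw [← act_zPerm_decr μ, act_zPerm_decr μ]
      nth_rewrite 2 [← act_zPerm_decr μ]
      exact act_inv_act _ _
    simp only [hneg, h]
    exact (antitone_decr μ).neg
  · rw [length_inv, ← length_inv y]
    refine hz.2 _ ?_
    simp only [hneg] at hy
    have h : Antitone (act y μ) := by
      intro a b hab
      have := hy hab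
      simpa using this
    rw [← eq_decr_of_antitone h, act_inv_act]

theorem decr_act (z : Equiv.Perm (Fin (m + 1))) (μ : Fin (m + 1) → ℤ) :
    decr (act z μ) = decr μ := by
  have h : act (zPerm (act z μ))⁻¹ (act z μ) = decr (act z μ) := by
    nth_rewrite 2 [← act_zPerm_decr (act z μ)]
    exact act_inv_act _ _
  rw [← h, ← act_mul]
  refine eq_decr_of_antitone ?_
  rw [act_mul, h]
  exact antitone_decr _

theorem decr_of_antitone {μ : Fin (m + 1) → ℤ} (h : Antitone μ) : decr μ = μ := by
  have h1 : act 1 μ = decr μ := eq_decr_of_antitone (by rwa [act_one])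
  rw [← h1, act_one]

theorem zPerm_eq_one {μ : Fin (m + 1) → ℤ} (h : Antitone μ) : zPerm μ = 1 := by
  have h1 : IsStableSort (-μ) 1 := by
    refine isStableSort_of_imp fun a b hab => ?_
    rcases hab with h' | ⟨-, h'⟩
    · by_contra hlt
      have := h (not_lt.mp hlt)
      simp at h' this
      omega
    · exact h'
  simpa using (isStableSort_zPerm_inv μ).unique h1

theorem zPerm_act_s {i : Fin m} {μ : Fin (m + 1) → ℤ} (h : μ i.castSucc ≠ μ i.succ) :
    zPerm (act (s i) μ) = s i * zPerm μ := by
  have hz := isStableSort_zPerm_inv μ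
  have h1 : IsStableSort (-act (s i) μ) (s i * zPerm μ)⁻¹ := by
    refine isStableSort_of_imp fun a b hab => ?_
    rw [mul_inv_rev, Equiv.Perm.mul_apply, Equiv.Perm.mul_apply, hz, s_inv]
    rcases hab with h' | ⟨h', hlt⟩
    · exact Or.inl (by simpa [act, s_inv] using h')
    · simp only [Pi.neg_apply, neg_inj, act, s_inv] at h'
      refine Or.inr ⟨by simpa using h', s_lt i hlt ?_⟩
      rintro ⟨rfl, rfl⟩
      rw [s_castSucc, s_succ] at h'
      exact h h'.symm
  exact inv_injective ((isStableSort_zPerm_inv _).unique h1)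

/-! ### Independence of the reduced word -/

theorem length_s_mul_of_gt (z : Equiv.Perm (Fin (m + 1))) (i : Fin m)
    (h : z⁻¹ i.succ < z⁻¹ i.castSucc) : length (s i * z) + 1 = length z := by
  have := length_mul_s z⁻¹ i h
  rwa [length_inv, ← length_inv, mul_inv_rev, inv_inv, s_inv] at this

theorem length_s_mul_of_lt (z : Equiv.Perm (Fin (m + 1))) (i : Fin m)
    (h : z⁻¹ i.castSucc < z⁻¹ i.succ) : length (s i * z) = length z + 1 := by
  have := length_s_mul_of_gt (s i * z) i
    (by rwa [s_mul_inv_apply_castSucc, s_mul_inv_apply_succ])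
  rw [← mul_assoc, s_mul_s, one_mul] at this
  exact this.symm

theorem lt_or_gt_inv (z : Equiv.Perm (Fin (m + 1))) (i : Fin m) :
    z⁻¹ i.castSucc < z⁻¹ i.succ ∨ z⁻¹ i.succ < z⁻¹ i.castSucc :=
  lt_or_gt_of_ne fun e => (Fin.castSucc_lt_succ (i := i)).ne (z⁻¹.injective e)

theorem length_prod_le (w : List (Fin m)) : length (w.map s).prod ≤ w.length := by
  induction w with
  | nil =>
    have h : inversions (1 : Equiv.Perm (Fin (m + 1))) = ∅ := by
      ext ⟨a, b⟩
      simp only [mem_inversions, Equiv.Perm.one_apply, Finset.notMem_empty, iff_false]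
      exact fun h => lt_asymm h.1 h.2
    simp [length, h]
  | cons i w ih =>
    rw [List.map_cons, List.prod_cons, List.length_cons]
    rcases lt_or_gt_inv (w.map s).prod i with h | h
    · rw [length_s_mul_of_lt _ _ h]; omega
    · have := length_s_mul_of_gt _ _ h; omega

theorem length_one : length (1 : Equiv.Perm (Fin (m + 1))) = 0 := by
  simpa using length_prod_le ([] : List (Fin m))

theorem isReducedWord_cons {z : Equiv.Perm (Fin (m + 1))} {i : Fin m} {w : List (Fin m)}
    (h : z⁻¹ i.succ < z⁻¹ i.castSucc) (hw : IsReducedWord (s i * z) w) :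
    IsReducedWord z (i :: w) := by
  refine ⟨?_, ?_⟩
  · rw [List.map_cons, List.prod_cons, hw.1, ← mul_assoc, s_mul_s, one_mul]
  · rw [List.length_cons, hw.2, length_s_mul_of_gt z i h]

theorem IsReducedWord.of_cons {z : Equiv.Perm (Fin (m + 1))} {i : Fin m} {w : List (Fin m)}
    (h : IsReducedWord z (i :: w)) :
    z⁻¹ i.succ < z⁻¹ i.castSucc ∧ IsReducedWord (s i * z) w := by
  obtain ⟨h1, h2⟩ := h
  rw [List.map_cons, List.prod_cons] at h1
  rw [List.length_cons] at h2
  have h3 : (w.map s).prod = s i * z := by rw [← h1, ← mul_assoc, s_mul_s, one_mul]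
  have h4 := length_prod_le w
  rw [h3] at h4
  rcases lt_or_gt_inv z i with h | h
  · have := length_s_mul_of_lt z i h; omega
  · have := length_s_mul_of_gt z i h
    exact ⟨h, h3, by omega⟩

/-- Matsumoto's theorem for the symmetric group: elements of a monoid that satisfy the braid
relations have the same product along any two reduced words of a permutation. -/
theorem prod_eq_of_isReducedWord {M : Type*} [Monoid M] {a : Fin m → M}
    (hcomm : ∀ i j : Fin m, (i : ℕ) + 2 ≤ j → a i * a j = a j * a i)
    (hbraid : ∀ i j : Fin m, j.castSucc = i.succ → a i * a j * a i = a j * a i * a j)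
    {z : Equiv.Perm (Fin (m + 1))} {w w' : List (Fin m)} (hw : IsReducedWord z w)
    (hw' : IsReducedWord z w') : (w.map a).prod = (w'.map a).prod := by
  generalize hk : length z = k
  induction k using Nat.strong_induction_on generalizing z w w' with
  | _ k ih =>
  rcases w with _ | ⟨i, w⟩
  · have h1 := hw.2
    have h2 := hw'.2
    rw [List.length_nil] at h1
    rw [← h1] at h2
    rw [List.eq_nil_of_length_eq_zero h2]
  rcases w' with _ | ⟨j, w'⟩
  · have h1 := hw.2
    have h2 := hw'.2
    rw [List.length_nil] at h2
    rw [← h2] at h1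
    rw [List.eq_nil_of_length_eq_zero h1]
  wlog hij : i ≤ j generalizing i j w w'
  · exact (this j _ hw' i _ hw (le_of_not_ge hij)).symm
  obtain ⟨di, hwi⟩ := hw.of_cons
  obtain ⟨dj, hwj⟩ := hw'.of_cons
  have li := length_s_mul_of_gt z i di
  have lj := length_s_mul_of_gt z j dj
  simp only [List.map_cons, List.prod_cons]
  rcases hij.eq_or_lt with rfl | hlt
  · rw [ih _ (by omega) hwi hwj rfl]
  have hlt' : (i : ℕ) < j := hlt
  rcases (show (i : ℕ) + 1 ≤ j from hlt').eq_or_lt with e | hlt'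
  · have hij : j.castSucc = i.succ := by ext; simp; omega
    have hne1 : s i j.succ = j.succ := s_of_ne i
      (by simp only [Ne, Fin.ext_iff, Fin.val_succ, Fin.val_castSucc]; omega)
      (by simp only [Ne, Fin.ext_iff, Fin.val_succ]; omega)
    have hne2 : s j i.castSucc = i.castSucc := s_of_ne j
      (by simp only [Ne, Fin.ext_iff, Fin.val_castSucc]; omega)
      (by simp only [Ne, Fin.ext_iff, Fin.val_succ, Fin.val_castSucc]; omega)
    have d1 : (s i * z)⁻¹ j.succ < (s i * z)⁻¹ j.castSucc := by
      rw [hij, s_mul_inv_apply_succ, mul_inv_rev, s_inv, Equiv.Perm.mul_apply, hne1]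
      rw [hij] at dj
      exact dj.trans di
    have d2 : (s j * (s i * z))⁻¹ i.succ < (s j * (s i * z))⁻¹ i.castSucc := by
      rw [← hij, s_mul_inv_apply_castSucc, mul_inv_rev, mul_inv_rev, s_inv, s_inv,
        Equiv.Perm.mul_apply, Equiv.Perm.mul_apply, hne1, hne2, s_mul_inv_apply_castSucc, ← hij]
      exact dj
    obtain ⟨r, hr⟩ := exists_isReducedWord (s i * (s j * (s i * z)))
    have l1 := length_s_mul_of_gt _ _ d1
    have l2 := length_s_mul_of_gt _ _ d2
    have r1 : IsReducedWord (s i * z) (j :: i :: r) :=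
      isReducedWord_cons d1 (isReducedWord_cons d2 hr)
    have r2 : IsReducedWord (s j * z) (i :: j :: r) := by
      refine ⟨?_, ?_⟩
      · rw [List.map_cons, List.prod_cons, List.map_cons, List.prod_cons, hr.1]
        have hb := s_braid hij
        calc s i * (s j * (s i * (s j * (s i * z)))) =
            s i * s j * s i * s j * s i * z := by simp only [mul_assoc]
          _ = s j * s i * (s j * s j) * s i * z := by rw [hb]; simp only [mul_assoc]
          _ = s j * (s i * s i) * z := by rw [s_mul_s]; simp only [mul_assoc, one_mul]
          _ = s j * z := by rw [s_mul_s, mul_one]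
      · rw [List.length_cons, List.length_cons, hr.2]; omega
    rw [ih _ (by omega) hwi r1 rfl, ih _ (by omega) hwj r2 rfl]
    simp only [List.map_cons, List.prod_cons, ← mul_assoc, hbraid i j hij]
  · have hval : (i : ℕ) + 2 ≤ j := by omega
    have hs : s i * s j = s j * s i := s_mul_s_comm
      (by simp only [Ne, Fin.ext_iff, Fin.val_succ, Fin.val_castSucc]; omega)
      (by simp only [Ne, Fin.ext_iff, Fin.val_succ, Fin.val_castSucc]; omega) hlt.ne
    have hne1 : s i j.succ = j.succ := s_of_ne i
      (by simp only [Ne, Fin.ext_iff, Fin.val_succ, Fin.val_castSucc]; omega)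
      (by simp only [Ne, Fin.ext_iff, Fin.val_succ]; omega)
    have hne2 : s i j.castSucc = j.castSucc := s_of_ne i
      (by simp only [Ne, Fin.ext_iff, Fin.val_castSucc]; omega)
      (by simp only [Ne, Fin.ext_iff, Fin.val_succ, Fin.val_castSucc]; omega)
    have d1 : (s i * z)⁻¹ j.succ < (s i * z)⁻¹ j.castSucc := by
      rw [mul_inv_rev, s_inv, Equiv.Perm.mul_apply, Equiv.Perm.mul_apply, hne1, hne2]
      exact dj
    obtain ⟨r, hr⟩ := exists_isReducedWord (s j * (s i * z))
    have l1 := length_s_mul_of_gt _ _ d1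
    have r1 : IsReducedWord (s i * z) (j :: r) := isReducedWord_cons d1 hr
    have r2 : IsReducedWord (s j * z) (i :: r) := by
      refine ⟨?_, ?_⟩
      · rw [List.map_cons, List.prod_cons, hr.1, ← mul_assoc, ← mul_assoc, hs, mul_assoc (s j),
          s_mul_s, mul_one]
      · rw [List.length_cons, hr.2]; omega
    rw [ih _ (by omega) hwi r1 rfl, ih _ (by omega) hwj r2 rfl]
    simp only [List.map_cons, List.prod_cons, ← mul_assoc, hcomm i j hval]

theorem TPerm_eq (u : ℂ) {z : Equiv.Perm (Fin (m + 1))} {w : List (Fin m)}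
    (hw : IsReducedWord z w) : TPerm u z = (w.map (T u)).prod :=
  prod_eq_of_isReducedWord (fun _ _ h => (T_comm u h).eq) (fun _ _ h => T_braid u h)
    (exists_isReducedWord z).choose_spec hw

theorem TPerm_one (u : ℂ) : TPerm u (1 : Equiv.Perm (Fin (m + 1))) = 1 :=
  TPerm_eq u (w := []) ⟨by simp, by simp [length_one]⟩

theorem TPerm_s_mul (u : ℂ) {z : Equiv.Perm (Fin (m + 1))} {i : Fin m}
    (h : z⁻¹ i.castSucc < z⁻¹ i.succ) : TPerm u (s i * z) = T u i * TPerm u z := by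
  obtain ⟨w, hw⟩ := exists_isReducedWord z
  have h' : IsReducedWord (s i * z) (i :: w) :=
    isReducedWord_cons (by rwa [s_mul_inv_apply_castSucc, s_mul_inv_apply_succ])
      (by rwa [← mul_assoc, s_mul_s, one_mul])
  rw [TPerm_eq u hw, TPerm_eq u h', List.map_cons, List.prod_cons]

theorem TPerm_mul_s (u : ℂ) {z : Equiv.Perm (Fin (m + 1))} {i : Fin m}
    (h : z i.castSucc < z i.succ) : TPerm u (z * s i) = TPerm u z * T u i := by
  obtain ⟨w, hw⟩ := exists_isReducedWord z
  have hl := length_mul_s (z * s i) i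
    (by rwa [Equiv.Perm.mul_apply, Equiv.Perm.mul_apply, s_succ, s_castSucc])
  rw [mul_assoc, s_mul_s, mul_one] at hl
  have h' : IsReducedWord (z * s i) (w ++ [i]) :=
    ⟨by simp [hw.1], by rw [List.length_append, hw.2, ← hl]; rfl⟩
  rw [TPerm_eq u hw, TPerm_eq u h', List.map_append, List.prod_append]
  simp

/-! ### The joint spectrum of the Cherednik-Dunkl operators -/

theorem lt_of_eigenvalue_eq {q u : ℂ} (hq : q ≠ 0) (hu : u ≠ 0)
    (hqu : ∀ a b : ℕ, 1 ≤ a → b ≤ m → q ^ a * (u ^ 2) ^ b ≠ 1) {x y : ℤ} {a b : Fin (m + 1)}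
    (h : q ^ (-x) * u ^ (-2 * ((a : ℕ) : ℤ) + (m : ℤ)) =
      q ^ (-y) * u ^ (-2 * ((b : ℕ) : ℤ) + (m : ℤ))) (hxy : y < x) : a < b := by
  by_contra hab
  have hab' : (b : ℕ) ≤ a := not_lt.mp hab
  refine hqu (x - y).toNat (a - b) (by omega) (by omega) ?_
  rw [← pow_mul, ← zpow_natCast q, ← zpow_natCast u]
  have e1 : (((x - y).toNat : ℕ) : ℤ) = -y - -x := by omega
  have e2 : ((2 * ((a : ℕ) - (b : ℕ)) : ℕ) : ℤ) =
      (-2 * ((b : ℕ) : ℤ) + (m : ℤ)) - (-2 * ((a : ℕ) : ℤ) + (m : ℤ)) := by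
    omega
  rw [e1, e2, zpow_sub₀ hq, zpow_sub₀ hu, div_mul_div_comm, ← h, div_self]
  exact mul_ne_zero (zpow_ne_zero _ hq) (zpow_ne_zero _ hu)

/-- If `v` sorts `μ`, replacing `v` by another permutation does not increase `∑ v j μ j`. -/
theorem sum_mul_le_of_sorts {μ : Fin (m + 1) → ℤ} {v : Equiv.Perm (Fin (m + 1))}
    (hv : ∀ a b, μ a < μ b → v a < v b) (w : Equiv.Perm (Fin (m + 1))) :
    ∑ j, ((w j : ℕ) : ℤ) * μ j ≤ ∑ j, ((v j : ℕ) : ℤ) * μ j := by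
  have h : Monovary (fun j => ((v j : ℕ) : ℤ)) μ := fun a b hab =>
    Int.ofNat_le.mpr (Fin.le_def.mp (hv a b hab).le)
  simpa using h.sum_comp_perm_mul_le_sum_mul (σ := v⁻¹ * w)

/-- The joint eigenvalues attached to distinct exponents are distinct. Each difference
`(μ j - ν j) (v j - w j)` would be nonpositive, with equality only for `μ j = ν j`, while the sum of
these differences is nonnegative by the rearrangement inequality. -/
theorem eq_of_eigenvalues_eq {q u : ℂ} (hq : q ≠ 0) (hu : u ≠ 0)
    (hqu : ∀ a b : ℕ, 1 ≤ a → b ≤ m → q ^ a * (u ^ 2) ^ b ≠ 1) {μ ν : Fin (m + 1) → ℤ}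
    {v w : Equiv.Perm (Fin (m + 1))} (hv : ∀ a b, μ a < μ b → v a < v b)
    (hw : ∀ a b, ν a < ν b → w a < w b)
    (h : ∀ k, q ^ (-μ k) * u ^ (-2 * ((v k : ℕ) : ℤ) + (m : ℤ)) =
      q ^ (-ν k) * u ^ (-2 * ((w k : ℕ) : ℤ) + (m : ℤ))) : μ = ν := by
  have hle : ∀ j, (μ j - ν j) * (((v j : ℕ) : ℤ) - ((w j : ℕ) : ℤ)) ≤ 0 ∧
      (μ j ≠ ν j → (μ j - ν j) * (((v j : ℕ) : ℤ) - ((w j : ℕ) : ℤ)) < 0) := by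
    intro j
    rcases lt_trichotomy (μ j) (ν j) with h' | h' | h'
    · have h1 : w j < v j := lt_of_eigenvalue_eq hq hu hqu (h j).symm h'
      have h2 : ((w j : ℕ) : ℤ) < ((v j : ℕ) : ℤ) := by exact_mod_cast h1
      have h3 := mul_neg_of_neg_of_pos (sub_neg.mpr h') (sub_pos.mpr h2)
      exact ⟨h3.le, fun _ => h3⟩
    · simp [h']
    · have h1 : v j < w j := lt_of_eigenvalue_eq hq hu hqu (h j) h'
      have h2 : ((v j : ℕ) : ℤ) < ((w j : ℕ) : ℤ) := by exact_mod_cast h1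
      have h3 := mul_neg_of_pos_of_neg (sub_pos.mpr h') (sub_neg.mpr h2)
      exact ⟨h3.le, fun _ => h3⟩
  by_contra hne
  obtain ⟨j, hj⟩ := Function.ne_iff.mp hne
  have h1 : ∑ j, (μ j - ν j) * (((v j : ℕ) : ℤ) - ((w j : ℕ) : ℤ)) < 0 :=
    Finset.sum_neg' (fun j _ => (hle j).1) ⟨j, Finset.mem_univ _, (hle j).2 hj⟩
  have h2 : ∑ j, (μ j - ν j) * (((v j : ℕ) : ℤ) - ((w j : ℕ) : ℤ)) =
      (∑ j, ((v j : ℕ) : ℤ) * μ j - ∑ j, ((w j : ℕ) : ℤ) * μ j) +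
        (∑ j, ((w j : ℕ) : ℤ) * ν j - ∑ j, ((v j : ℕ) : ℤ) * ν j) := by
    rw [← Finset.sum_sub_distrib, ← Finset.sum_sub_distrib, ← Finset.sum_add_distrib]
    exact Finset.sum_congr rfl fun j _ => by ring
  have h3 := sum_mul_le_of_sorts hv w
  have h4 := sum_mul_le_of_sorts hw v
  omega

theorem IsStableSort.sorts {μ : Fin (m + 1) → ℤ} {v : Equiv.Perm (Fin (m + 1))}
    (h : IsStableSort μ v) : ∀ a b, μ a < μ b → v a < v b := fun a b hab => (h a b).mpr (Or.inl hab)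

theorem eigenvalue_eq (q u : ℂ) (μ : Fin (m + 1) → ℤ) (k : Fin (m + 1)) :
    eigenvalue q u μ k = q ^ (-μ k) * u ^ (-2 * ((vPerm μ k : ℕ) : ℤ) + (m : ℤ)) := by
  rw [eigenvalue, (isStableSort_vPerm μ).val_eq]

theorem sub_coeff_smul_mono_mem {F : Laurent m} {ν : Fin (m + 1) → ℤ}
    {S : Set (Fin (m + 1) → ℤ)} (hF : F ∈ supportedOn S) :
    F - F.coeff ν • mono ν ∈ supportedOn (S \ {ν}) := by
  intro κ hκ
  by_cases h : κ = ν
  · subst h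
    simp [AddMonoidAlgebra.coeff_sub, coeff_mono] at hκ
  · refine ⟨hF κ ?_, h⟩
    simpa [AddMonoidAlgebra.coeff_sub, coeff_mono, Ne.symm h] using hκ

/-- The leading exponent of a joint eigenvector is determined by its eigenvalues. -/
theorem leading_of_eigenvector {q u : ℂ} (hq : q ≠ 0) (hu : u ≠ 0)
    (hqu : ∀ a b : ℕ, 1 ≤ a → b ≤ m → q ^ a * (u ^ 2) ^ b ≠ 1) {μ : Fin (m + 1) → ℤ}
    {v : Equiv.Perm (Fin (m + 1))} (hv : ∀ a b, μ a < μ b → v a < v b) {F : Laurent m}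
    (hF : F ≠ 0)
    (h : ∀ k, Y q u k F = (q ^ (-μ k) * u ^ (-2 * ((v k : ℕ) : ℤ) + (m : ℤ))) • F) :
    F.coeff μ ≠ 0 ∧ F ∈ supportedOn {ν | rank ν ≤ rank μ} := by
  have hne : F.coeff.support.Nonempty := by
    rw [Finset.nonempty_iff_ne_empty, Ne, Finsupp.support_eq_empty, AddMonoidAlgebra.coeff_eq_zero]
    exact hF
  obtain ⟨ν, hν, hmax⟩ := Finset.exists_max_image _ rank hne
  have hν' : F.coeff ν ≠ 0 := Finsupp.mem_support_iff.mp hν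
  have hsup : F ∈ supportedOn {κ | rank κ ≤ rank ν} := fun κ hκ =>
    hmax κ (Finsupp.mem_support_iff.mpr hκ)
  suffices e : μ = ν by
    subst e
    exact ⟨hν', hsup⟩
  refine eq_of_eigenvalues_eq hq hu hqu hv (isStableSort_vPerm ν).sorts fun k => ?_
  rw [← eigenvalue_eq]
  have htri := isTriangular_Y (q := q) hu k
  have h1 : Y q u k (F - F.coeff ν • mono ν) ∈ supportedOn {ν}ᶜ := by
    refine map_mem_of_mem_supportedOn (fun κ hκ => ?_) (sub_coeff_smul_mono_mem hsup)
    rw [← sub_add_cancel (Y q u k (mono κ)) (eigenvalue q u κ k • mono κ)]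
    refine Submodule.add_mem _ (supportedOn_mono ?_ (htri κ))
      (Submodule.smul_mem _ _ (mono_mem_supportedOn hκ.2))
    rintro κ' (h1 : rank κ' < rank κ) (rfl : κ' = ν)
    exact absurd hκ.1 (not_le.mpr h1)
  have h2 : Y q u k (mono ν) - eigenvalue q u ν k • mono ν ∈ supportedOn {ν}ᶜ := by
    refine supportedOn_mono ?_ (htri ν)
    rintro κ' (h1 : rank κ' < rank ν) (rfl : κ' = ν)
    exact lt_irrefl _ h1
  have h3 := coeff_eq_zero_of_notMem (Submodule.add_mem _ h1 (Submodule.smul_mem _ (F.coeff ν) h2))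
    (show ν ∉ ({ν}ᶜ : Set _) from fun h => h rfl)
  have h4 : Y q u k (F - F.coeff ν • mono ν) +
      F.coeff ν • (Y q u k (mono ν) - eigenvalue q u ν k • mono ν) =
      Y q u k F - (F.coeff ν * eigenvalue q u ν k) • mono ν := by
    rw [map_sub, map_smul, smul_sub, smul_smul]
    abel
  rw [h4, h k] at h3
  simp only [AddMonoidAlgebra.coeff_sub, AddMonoidAlgebra.coeff_smul, Finsupp.sub_apply,
    Finsupp.smul_apply, smul_eq_mul, coeff_mono, if_true, mul_one] at h3
  apply mul_left_cancel₀ hν'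
  linear_combination h3

/-! ### Nonsymmetric Macdonald polynomials -/

/-- An operator that commutes with all `Yₖ`, preserves the leading term `x^μ` up to a nonzero
factor, and annihilates the monomials that lie, with all monomials of smaller rank, in a given
finite set of exponents below `μ`. It is a product of factors `Yₖ - c`, one for each of these exponents. -/
theorem exists_annihilator {q u : ℂ} (hq : q ≠ 0) (hu : u ≠ 0)
    (hqu : ∀ a b : ℕ, 1 ≤ a → b ≤ m → q ^ a * (u ^ 2) ^ b ≠ 1) (μ : Fin (m + 1) → ℤ)
    (S : Finset (Fin (m + 1) → ℤ)) (hS : ∀ ν ∈ S, rank ν < rank μ) :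
    ∃ (P : Module.End ℂ (Laurent m)) (d : (Fin (m + 1) → ℤ) → ℂ),
      (∀ k, Commute P (Y q u k)) ∧ IsTriangular P d ∧ d μ ≠ 0 ∧
      ∀ ν ∈ S, (∀ κ, rank κ < rank ν → κ ∈ S) → P (mono ν) = 0 := by
  classical
  induction S using Finset.induction_on_max_value rank with
  | empty =>
    exact ⟨1, fun _ => 1, fun k => Commute.one_left _, IsTriangular.one, one_ne_zero, by simp⟩
  | insert a S haS hmax ih =>
    obtain ⟨P, d, hP1, hP2, hP3, hP4⟩ := ih fun ν hν => hS ν (Finset.mem_insert_of_mem hν)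
    obtain ⟨k, hk⟩ : ∃ k, eigenvalue q u a k ≠ eigenvalue q u μ k := by
      by_contra hno
      push Not at hno
      have := eq_of_eigenvalues_eq hq hu hqu (isStableSort_vPerm a).sorts
        (isStableSort_vPerm μ).sorts fun k => by rw [← eigenvalue_eq, ← eigenvalue_eq, hno k]
      exact absurd (hS a (Finset.mem_insert_self _ _)) (by rw [this]; exact lt_irrefl _)
    set c := eigenvalue q u a k with hc
    set Q := Y q u k - c • (1 : Module.End ℂ (Laurent m)) with hQ
    have hQtri : IsTriangular Q fun ν => eigenvalue q u ν k - c := by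
      intro ν
      have := isTriangular_Y (q := q) hu k ν
      convert this using 1
      rw [hQ, LinearMap.sub_apply, LinearMap.smul_apply, Module.End.one_apply, sub_smul]
      abel
    have hQcomm : ∀ l, Commute Q (Y q u l) := fun l =>
      (commute_Y hq hu k l).sub_left ((Commute.one_left _).smul_left _)
    have hPQ : Commute P Q := (hP1 k).sub_right ((Commute.one_right _).smul_right _)
    refine ⟨P * Q, _, fun l => (hP1 l).mul_left (hQcomm l), hP2.mul hQtri,
      mul_ne_zero hP3 (sub_ne_zero.mpr hk.symm), fun ν hν hdown => ?_⟩
    rcases Finset.mem_insert.mp hν with rfl | hν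
    · have h1 : Q (mono ν) ∈ lower ν := by
        have := hQtri ν
        simpa [← hc] using this
      have h2 : P (Q (mono ν)) ∈ (⊥ : Submodule ℂ (Laurent m)) := by
        refine map_mem_of_mem_supportedOn (fun κ hκ => ?_) h1
        have hκ' : rank κ < rank ν := hκ
        have hmem : ∀ κ', rank κ' < rank ν → κ' ∈ S := fun κ' h' =>
          (Finset.mem_insert.mp (hdown κ' h')).resolve_left fun e => by
            rw [e] at h'; exact lt_irrefl _ h'
        rw [Submodule.mem_bot]
        exact hP4 κ (hmem κ hκ') fun κ' h' => hmem κ' (h'.trans hκ')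
      exact h2
    · rw [hPQ.eq, Module.End.mul_apply, hP4 ν hν, map_zero]
      intro κ hκ
      refine (Finset.mem_insert.mp (hdown κ hκ)).resolve_left fun e => ?_
      rw [e] at hκ
      exact absurd (hmax ν hν) (not_le.mpr hκ)

theorem exists_isMacdonaldE {q u : ℂ} (hq : q ≠ 0) (hu : u ≠ 0)
    (hqu : ∀ a b : ℕ, 1 ≤ a → b ≤ m → q ^ a * (u ^ 2) ^ b ≠ 1) (μ : Fin (m + 1) → ℤ) :
    ∃ E, IsMacdonaldE q u μ E := by
  obtain ⟨P, d, hP1, hP2, hP3, hP4⟩ := exists_annihilator hq hu hqu μ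
    (finite_setOf_rank_lt μ).toFinset fun ν hν =>
      ((finite_setOf_rank_lt μ).mem_toFinset.mp hν :)
  have hmem : ∀ ν, rank ν < rank μ → P (mono ν) = 0 := fun ν hν =>
    hP4 ν ((Set.Finite.mem_toFinset _).mpr hν) fun κ hκ =>
      (Set.Finite.mem_toFinset _).mpr (show rank κ < rank μ from hκ.trans hν)
  have hlow : ∀ h ∈ lower μ, P h = 0 := fun h hh =>
    (Submodule.mem_bot ℂ).mp
      (map_mem_of_mem_supportedOn (fun ν hν => (Submodule.mem_bot ℂ).mpr (hmem ν hν)) hh)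
  refine ⟨(d μ)⁻¹ • P (mono μ), fun k => ?_, ?_⟩
  · rw [← eigenvalue_eq]
    have h1 := hlow _ (isTriangular_Y (q := q) hu k μ)
    rw [map_sub, map_smul, sub_eq_zero, ← Module.End.mul_apply, (hP1 k).eq,
      Module.End.mul_apply] at h1
    rw [map_smul, h1, smul_comm]
  · have h1 := coeff_eq_zero_of_notMem (hP2 μ)
      (show μ ∉ {ν | rank ν < rank μ} from fun h => lt_irrefl (rank μ) h)
    simp only [AddMonoidAlgebra.coeff_sub, AddMonoidAlgebra.coeff_smul, Finsupp.sub_apply,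
      Finsupp.smul_apply, smul_eq_mul, coeff_mono, if_true, mul_one, sub_eq_zero] at h1
    rw [AddMonoidAlgebra.coeff_smul, Finsupp.smul_apply, h1, smul_eq_mul, inv_mul_cancel₀ hP3]

theorem IsMacdonaldE.unique {q u : ℂ} (hq : q ≠ 0) (hu : u ≠ 0)
    (hqu : ∀ a b : ℕ, 1 ≤ a → b ≤ m → q ^ a * (u ^ 2) ^ b ≠ 1) {μ : Fin (m + 1) → ℤ}
    {E E' : Laurent m} (hE : IsMacdonaldE q u μ E) (hE' : IsMacdonaldE q u μ E') : E = E' := by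
  by_contra hne
  refine (leading_of_eigenvector hq hu hqu (isStableSort_vPerm μ).sorts (sub_ne_zero.mpr hne)
    fun k => ?_).1 ?_
  · rw [map_sub, hE.1, hE'.1, smul_sub]
  · rw [AddMonoidAlgebra.coeff_sub, Finsupp.sub_apply, hE.2, hE'.2, sub_self]

theorem isMacdonaldE_macdonaldE {q u : ℂ} (hq : q ≠ 0) (hu : u ≠ 0)
    (hqu : ∀ a b : ℕ, 1 ≤ a → b ≤ m → q ^ a * (u ^ 2) ^ b ≠ 1) (μ : Fin (m + 1) → ℤ) :
    IsMacdonaldE q u μ (macdonaldE q u μ) :=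
  Classical.epsilon_spec (exists_isMacdonaldE hq hu hqu μ)

theorem position_succ {μ : Fin (m + 1) → ℤ} {j : Fin m} (h : μ j.castSucc = μ j.succ) :
    position μ j.succ = position μ j.castSucc + 1 := by
  have hins : (Finset.univ.filter fun l => Precedes μ l j.succ) =
      insert j.castSucc (Finset.univ.filter fun l => Precedes μ l j.castSucc) := by
    ext l
    simp only [Finset.mem_filter, Finset.mem_univ, true_and, Finset.mem_insert, Precedes, h,
      Fin.lt_def, Fin.ext_iff, Fin.val_succ, Fin.val_castSucc]
    constructor
    · rintro (h1 | ⟨h1, h2⟩)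
      · exact Or.inr (Or.inl h1)
      · by_cases h3 : (l : ℕ) = j
        · exact Or.inl h3
        · exact Or.inr (Or.inr ⟨h1, by omega⟩)
    · rintro (h1 | h1 | ⟨h1, h2⟩)
      · obtain rfl : l = j.castSucc := Fin.ext h1
        exact Or.inr ⟨h, by simp⟩
      · exact Or.inl h1
      · exact Or.inr ⟨h1, by omega⟩
  rw [position, hins, Finset.card_insert_of_notMem, position]
  simpa using precedes_irrefl μ j.castSucc

theorem DL_mono_mem (t : ℂ) (i : Fin m) (ν : Fin (m + 1) → ℤ) :
    DL t i (mono ν) ∈ supportedOn {κ | κ = ν ∨ κ = act (s i) ν ∨ normSq κ < normSq ν} := by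
  set P := supportedOn {κ | κ = ν ∨ κ = act (s i) ν ∨ normSq κ < normSq ν} with hP
  have h1 : mono ν ∈ P := mono_mem_supportedOn (Or.inl rfl)
  have h2 : mono (act (s i) ν) ∈ P := mono_mem_supportedOn (Or.inr (Or.inl rfl))
  have h3 : shorter (normSq ν) ≤ P := supportedOn_mono fun κ hκ => Or.inr (Or.inr hκ)
  rcases lt_trichotomy (ν i.castSucc) (ν i.succ) with h | h | h
  · exact (Submodule.sub_mem_iff_left _ (Submodule.add_mem _ (Submodule.smul_mem _ _ h1)
      (Submodule.smul_mem _ _ h2))).mp (h3 (DL_mono_of_lt t h))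
  · rw [DL_mono_of_eq t h]
    exact Submodule.smul_mem _ _ h1
  · exact (Submodule.sub_mem_iff_left _ h2).mp (h3 (DL_mono_of_gt t h))

/-- If two neighbouring entries of `μ` agree, then `E_μ` is an eigenvector of the corresponding
operator `Tⱼ`. The difference `Tⱼ E_μ - u E_μ` is a joint eigenvector of the `Yₖ` with two
eigenvalues exchanged; its coefficient at `x^μ` vanishes, so it is zero. -/
theorem T_macdonaldE {q u : ℂ} (hq : q ≠ 0) (hu : u ≠ 0)
    (hqu : ∀ a b : ℕ, 1 ≤ a → b ≤ m → q ^ a * (u ^ 2) ^ b ≠ 1) {μ : Fin (m + 1) → ℤ} {j : Fin m}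
    (hj : μ j.castSucc = μ j.succ) {E : Laurent m} (hE : IsMacdonaldE q u μ E) :
    T u j E = u • E := by
  have hE0 : E ≠ 0 := by
    rintro rfl
    simpa using hE.2
  have hsup := (leading_of_eigenvector hq hu hqu (isStableSort_vPerm μ).sorts hE0 hE.1).2
  have hcoeff : (T u j E - u • E).coeff μ = 0 := by
    have h1 := sub_coeff_smul_mono_mem (ν := μ) hsup
    rw [hE.2, one_smul] at h1
    have h2 : T u j (E - mono μ) ∈ supportedOn {μ}ᶜ := by
      refine map_mem_of_mem_supportedOn (fun ν hν => ?_) h1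
      rw [T_eq, LinearMap.smul_apply]
      refine Submodule.smul_mem _ _ (supportedOn_mono ?_ (DL_mono_mem _ j ν))
      rintro κ h3 (rfl : κ = μ)
      have hle : normSq ν ≤ normSq κ := by
        rcases (show rank ν ≤ rank κ from hν.1).lt_or_eq with h4 | h4
        · rcases rank_lt_iff.mp h4 with h5 | h5
          · exact h5.le
          · exact h5.1.le
        · exact (congrArg (fun x => (ofLex x).1) h4).le
      rcases h3 with h3 | h3 | h3
      · exact hν.2 h3.symm
      · refine hν.2 ?_
        rw [Set.mem_singleton_iff, ← act_s_act_s j ν, ← h3, act_s_eq_self hj]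
      · exact absurd h3 (not_lt.mpr hle)
    have h3 : T u j (mono μ) = u • mono μ := by
      rw [T_eq, LinearMap.smul_apply, DL_mono_of_eq _ hj, smul_smul]
      congr 1
      field_simp
    have h4 := coeff_eq_zero_of_notMem h2 (show μ ∉ ({μ}ᶜ : Set _) from fun h => h rfl)
    rw [map_sub, h3, AddMonoidAlgebra.coeff_sub, Finsupp.sub_apply, AddMonoidAlgebra.coeff_smul,
      Finsupp.smul_apply, coeff_mono, if_pos rfl, smul_eq_mul, mul_one] at h4
    rw [AddMonoidAlgebra.coeff_sub, Finsupp.sub_apply, AddMonoidAlgebra.coeff_smul,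
      Finsupp.smul_apply, hE.2, smul_eq_mul, mul_one, h4]
  by_contra hne
  have hv : ∀ a b, μ a < μ b → (vPerm μ * s j) a < (vPerm μ * s j) b := by
    intro a b hab
    have h1 : ∀ c, μ (s j c) = μ c := fun c => by
      have := congrFun (act_s_eq_self hj) c
      simpa only [act, s_inv] using this
    exact (isStableSort_vPerm μ).sorts _ _ (by rwa [h1, h1])
  refine (leading_of_eigenvector hq hu hqu hv (sub_ne_zero.mpr hne) fun k => ?_).1 hcoeff
  have hTi : ∀ h, Tinv u j h = T u j h - (u - u⁻¹) • h := fun h => rfl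
  have e1 : Y q u j.castSucc * Tinv u j = T u j * Y q u j.succ := by
    rw [Y_succ hu, ← mul_assoc, ← mul_assoc, T_mul_Tinv hu, one_mul]
  have e2 : Y q u j.succ * T u j = Tinv u j * Y q u j.castSucc := by
    rw [Y_succ hu, mul_assoc, Tinv_mul_T hu, mul_one]
  have e1' := LinearMap.congr_fun e1 E
  have e2' := LinearMap.congr_fun e2 E
  set y := q ^ (-μ j.castSucc) * u ^ (-2 * ((vPerm μ j.castSucc : ℕ) : ℤ) + (m : ℤ)) with hy
  have hys : q ^ (-μ j.succ) * u ^ (-2 * ((vPerm μ j.succ : ℕ) : ℤ) + (m : ℤ)) =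
      y * (u ^ 2)⁻¹ := by
    rw [hy, hj, (isStableSort_vPerm μ).val_eq, (isStableSort_vPerm μ).val_eq, position_succ hj,
      mul_assoc]
    congr 1
    rw [← zpow_natCast u 2, ← zpow_neg, ← zpow_add₀ hu]
    congr 1
    push_cast
    ring
  have hE1 := hE.1 j.castSucc
  have hE2 := hE.1 j.succ
  rw [← hy] at hE1
  rw [hys] at hE2
  simp only [Module.End.mul_apply, hTi, map_sub, map_smul, hE1, hE2] at e1' e2'
  by_cases hk1 : k = j.castSucc
  · subst hk1
    rw [Equiv.Perm.mul_apply, s_castSucc, hj, hys, map_sub, map_smul, hE1,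
      sub_eq_iff_eq_add.mp e1']
    have h3 : (u - u⁻¹) * y - u * y = -(y * (u ^ 2)⁻¹ * u) := by
      field_simp
      ring
    rw [smul_sub, smul_smul, smul_smul, smul_smul, add_sub_assoc, ← sub_smul, h3, neg_smul,
      sub_eq_add_neg]
  · by_cases hk2 : k = j.succ
    · subst hk2
      rw [Equiv.Perm.mul_apply, s_succ, ← hj, ← hy, map_sub, map_smul, hE2, e2']
      rw [smul_sub, smul_smul, smul_smul, smul_smul, sub_sub, ← add_smul]
      congr 2
      field_simp
      ring
    · have hc : Commute (T u j) (Y q u k) := by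
        have hk1' : (k : ℕ) ≠ j := fun e => hk1 (Fin.ext e)
        have hk2' : (k : ℕ) ≠ j + 1 := fun e => hk2 (Fin.ext e)
        rcases lt_or_ge (k : ℕ) j with h | h
        · exact commute_T_Y_of_lt hq hu j k h
        · exact commute_T_Y_of_gt hq hu j k (by omega)
      have hc' := LinearMap.congr_fun hc.eq E
      simp only [Module.End.mul_apply] at hc'
      rw [Equiv.Perm.mul_apply, s_of_ne j hk1 hk2, map_sub, map_smul, ← hc', hE.1 k, map_smul,
        smul_sub, smul_comm u]

/-! ### The KZ-family -/

theorem f_of_antitone (q u : ℂ) {μ : Fin (m + 1) → ℤ} (h : Antitone μ) :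
    f q u μ = macdonaldE q u μ := by
  rw [f, zPerm_eq_one h, length_one, pow_zero, one_smul, TPerm_one, Module.End.one_apply,
    decr_of_antitone h]

theorem length_zPerm_act_s {i : Fin m} {μ : Fin (m + 1) → ℤ} (h : μ i.succ < μ i.castSucc) :
    length (zPerm (act (s i) μ)) = length (zPerm μ) + 1 := by
  rw [zPerm_act_s h.ne']
  exact length_s_mul_of_lt _ _ ((isStableSort_zPerm_inv μ _ _).mpr (Or.inl (by simpa using h)))

theorem smul_T_f_of_gt (q u : ℂ) {i : Fin m} {μ : Fin (m + 1) → ℤ} (h : μ i.succ < μ i.castSucc) :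
    u • T u i (f q u μ) = f q u (act (s i) μ) := by
  have hlt : (zPerm μ)⁻¹ i.castSucc < (zPerm μ)⁻¹ i.succ :=
    (isStableSort_zPerm_inv μ _ _).mpr (Or.inl (by simpa using h))
  rw [f, f, length_zPerm_act_s h, zPerm_act_s h.ne', TPerm_s_mul u hlt, decr_act, map_smul,
    smul_smul, pow_succ', Module.End.mul_apply]

/-- If `μ i = μ (i + 1)` then `sᵢ z_μ = z_μ sⱼ` for a position `j` at which the weakly decreasing
rearrangement of `μ` has equal neighbouring entries, so the claim follows from `T_macdonaldE`. -/
theorem T_f_of_eq {q u : ℂ} (hq : q ≠ 0) (hu : u ≠ 0)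
    (hqu : ∀ a b : ℕ, 1 ≤ a → b ≤ m → q ^ a * (u ^ 2) ^ b ≠ 1) {i : Fin m}
    {μ : Fin (m + 1) → ℤ} (h : μ i.castSucc = μ i.succ) : T u i (f q u μ) = u • f q u μ := by
  have hz := isStableSort_zPerm_inv μ
  have hsucc : (((zPerm μ)⁻¹ i.succ : Fin (m + 1)) : ℕ) = (zPerm μ)⁻¹ i.castSucc + 1 := by
    rw [hz.val_eq, hz.val_eq]
    exact position_succ (by simpa using h)
  have hlt : (zPerm μ)⁻¹ i.castSucc < (zPerm μ)⁻¹ i.succ := by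
    rw [Fin.lt_def]; omega
  obtain ⟨j, hj1, hj2⟩ : ∃ j : Fin m, zPerm μ j.castSucc = i.castSucc ∧
      zPerm μ j.succ = i.succ := by
    refine ⟨⟨(zPerm μ)⁻¹ i.castSucc, by omega⟩, ?_, ?_⟩
    · rw [← Equiv.Perm.eq_inv_iff_eq]; rfl
    · rw [← Equiv.Perm.eq_inv_iff_eq]; exact Fin.ext hsucc.symm
  have hcomm : s i * zPerm μ = zPerm μ * s j := by
    rw [s, s, Equiv.mul_swap_eq_swap_mul, hj1, hj2]
  have hdecr : decr μ j.castSucc = decr μ j.succ := by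
    rw [← act_apply_apply (zPerm μ) (decr μ) j.castSucc,
      ← act_apply_apply (zPerm μ) (decr μ) j.succ, act_zPerm_decr, hj1, hj2, h]
  have hT := T_macdonaldE hq hu hqu hdecr (isMacdonaldE_macdonaldE hq hu hqu (decr μ))
  rw [f, map_smul, ← Module.End.mul_apply, ← TPerm_s_mul u hlt, hcomm,
    TPerm_mul_s u (by rw [hj1, hj2]; exact Fin.castSucc_lt_succ), Module.End.mul_apply, hT,
    map_smul, smul_comm]

theorem tailProd_f (q u : ℂ) (k : Fin (m + 1)) (ν : Fin (m + 1) → ℤ) (h : ∀ j, k < j → ν j < ν k) :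
    u ^ (m - (k : ℕ)) • tailProd u k (f q u ν) = f q u (act (tailCycle k) ν) := by
  induction k using Fin.reverseInduction generalizing ν with
  | last => simp [tailProd_last, tailCycle_last, act_one]
  | cast k ih =>
    have hk : ν k.succ < ν k.castSucc := h _ Fin.castSucc_lt_succ
    have e : m - (k.castSucc : ℕ) = (m - (k.succ : ℕ)) + 1 := by simp; omega
    rw [tailProd_castSucc, Module.End.mul_apply, e, pow_succ, mul_smul, ← map_smul,
      smul_T_f_of_gt q u hk, ih, tailCycle_castSucc, act_mul]
    intro j hj
    rw [act_s_apply_succ]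
    have hj' : k.castSucc < j := Fin.castSucc_lt_succ.trans hj
    simp only [act, s_inv]
    rw [s_of_ne k hj'.ne' hj.ne']
    exact h j hj'

/-- The number of entries to the left of position `k` that are equal to the entry there. -/
def equalsBefore (ν : Fin (m + 1) → ℤ) (k : Fin (m + 1)) : ℕ :=
  (Finset.univ.filter fun j => j < k ∧ ν j = ν k).card

theorem partialProd_T_f {q u : ℂ} (hq : q ≠ 0) (hu : u ≠ 0)
    (hqu : ∀ a b : ℕ, 1 ≤ a → b ≤ m → q ^ a * (u ^ 2) ^ b ≠ 1) (k : Fin (m + 1))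
    (ν : Fin (m + 1) → ℤ) (h : ∀ j, j < k → ν k ≤ ν j) :
    u ^ (k : ℕ) • Fin.partialProd (T u) k (f q u ν) =
      (u ^ 2) ^ equalsBefore ν k • f q u (act (Fin.partialProd s k) ν) := by
  induction k using Fin.induction generalizing ν with
  | zero => simp [equalsBefore, Fin.partialProd_zero, act_one]
  | succ k ih =>
    have hne : ∀ j, j < k.castSucc → act (s k) ν j = ν j := by
      intro j hj
      simp only [act, s_inv]
      rw [s_of_ne k hj.ne (hj.trans Fin.castSucc_lt_succ).ne]
    have ih' := ih (act (s k) ν) fun j hj => by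
      rw [act_s_apply_castSucc, hne j hj]
      exact h j (hj.trans Fin.castSucc_lt_succ)
    rw [Fin.partialProd_succ, Fin.partialProd_succ, Module.End.mul_apply, act_mul, Fin.val_succ,
      pow_succ, mul_smul, ← map_smul]
    rw [Fin.val_castSucc] at ih'
    rcases (h k.castSucc Fin.castSucc_lt_succ).eq_or_lt with he | hlt
    · have hcount : equalsBefore ν k.succ = equalsBefore ν k.castSucc + 1 := by
        rw [equalsBefore, equalsBefore, ← Finset.card_insert_of_notMem (a := k.castSucc) (by simp)]
        congr 1
        ext j
        simp only [Finset.mem_filter, Finset.mem_univ, true_and, Finset.mem_insert, he, Fin.lt_def,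
          Fin.val_succ, Fin.val_castSucc, Fin.ext_iff]
        constructor
        · rintro ⟨h1, h2⟩
          by_cases h3 : (j : ℕ) = k
          · exact Or.inl h3
          · exact Or.inr ⟨by omega, h2⟩
        · rintro (h1 | ⟨h1, h2⟩)
          · obtain rfl : j = k.castSucc := Fin.ext h1
            exact ⟨by simp, rfl⟩
          · exact ⟨by omega, h2⟩
      rw [act_s_eq_self he.symm] at ih' ⊢
      rw [T_f_of_eq hq hu hqu he.symm, smul_smul, map_smul, smul_comm, ih', hcount, smul_smul]
      congr 1
      ring
    · have hcount : equalsBefore ν k.succ = equalsBefore (act (s k) ν) k.castSucc := by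
        rw [equalsBefore, equalsBefore]
        congr 1
        ext j
        simp only [Finset.mem_filter, Finset.mem_univ, true_and, act_s_apply_castSucc]
        constructor
        · rintro ⟨h1, h2⟩
          have h3 : j ≠ k.castSucc := by
            rintro rfl; exact hlt.ne' h2
          have h4 : j < k.castSucc := lt_of_le_of_ne (Fin.le_castSucc_iff.mpr h1) h3
          exact ⟨h4, by rw [hne j h4]; exact h2⟩
        · rintro ⟨h1, h2⟩
          exact ⟨h1.trans Fin.castSucc_lt_succ, by rwa [hne j h1] at h2⟩
      rw [smul_T_f_of_gt q u hlt, ih', hcount]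

theorem position_of_last_equal {ν : Fin (m + 1) → ℤ} (hν : Antitone ν) {k : Fin (m + 1)}
    (h : ∀ j, k < j → ν j < ν k) : position ν k = (m - (k : ℕ)) + equalsBefore ν k := by
  have hd : Disjoint (Finset.Ioi k) (Finset.univ.filter fun j => j < k ∧ ν j = ν k) := by
    rw [Finset.disjoint_left]
    intro a h1 h2
    simp only [Finset.mem_filter] at h2
    exact lt_asymm (Finset.mem_Ioi.mp h1) h2.2.1
  have hU : (Finset.univ.filter fun j => Precedes ν j k) =
      Finset.Ioi k ∪ Finset.univ.filter fun j => j < k ∧ ν j = ν k := by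
    ext j
    simp only [Finset.mem_filter, Finset.mem_univ, true_and, Finset.mem_union, Finset.mem_Ioi]
    constructor
    · rintro (h1 | ⟨h1, h2⟩)
      · refine Or.inl (lt_of_not_ge fun h3 => ?_)
        have := hν h3
        omega
      · exact Or.inr ⟨h2, h1⟩
    · rintro (h1 | ⟨h1, h2⟩)
      · exact Or.inl (h j h1)
      · exact Or.inr ⟨h2, h1⟩
  rw [position, hU, Finset.card_union_of_disjoint hd, Fin.card_Ioi, equalsBefore]
  omega

/-- If all entries of `μ` but the last are in weakly decreasing order, then `z_μ` moves one position
to the end and keeps the order of the others. -/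
theorem zPerm_eq_tailCycle {μ : Fin (m + 1) → ℤ} (h : Antitone fun j : Fin m => μ j.castSucc) :
    zPerm μ = tailCycle ((zPerm μ)⁻¹ (Fin.last m)) := by
  have hz := isStableSort_zPerm_inv μ
  set k := (zPerm μ)⁻¹ (Fin.last m) with hk
  have hmono : StrictMono fun j : Fin m => (zPerm μ)⁻¹ j.castSucc := by
    intro a b hab
    refine (hz _ _).mpr ?_
    rcases (h hab.le).eq_or_lt with e | hlt
    · exact Or.inr ⟨by simpa using e.symm, by simpa using hab⟩
    · exact Or.inl (by simpa using hlt)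
  have hrange : Set.range (fun j : Fin m => (zPerm μ)⁻¹ j.castSucc) =
      Set.range k.succAbove := by
    rw [Fin.range_succAbove]
    ext x
    simp only [Set.mem_range, Set.mem_compl_iff, Set.mem_singleton_iff]
    constructor
    · rintro ⟨j, rfl⟩ e
      exact (Fin.castSucc_lt_last j).ne ((zPerm μ)⁻¹.injective e)
    · intro hx
      have hne : zPerm μ x ≠ Fin.last m := by
        intro e; apply hx; rw [hk, ← e]; simp
      obtain ⟨j, hj⟩ := Fin.exists_castSucc_eq.mpr hne
      exact ⟨j, by rw [hj]; simp⟩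
  have heq := (hmono.range_inj (Fin.strictMono_succAbove k)).mp hrange
  have hinv : ∀ a, tailCycle k ((zPerm μ)⁻¹ a) = a := by
    intro a
    induction a using Fin.lastCases with
    | last => rw [← hk, tailCycle_self]
    | cast j =>
      have e : (zPerm μ)⁻¹ j.castSucc = k.succAbove j := congrFun heq j
      apply (Fin.partialProd s (Fin.last m)).injective
      rw [e, ← Equiv.Perm.mul_apply, partialProd_s_mul_tailCycle]
      ext
      rw [partialProd_s_apply, partialProd_s_apply, Fin.succAbove]
      simp only [Fin.lt_def, Fin.ext_iff, Fin.val_castSucc, Fin.val_last]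
      split_ifs <;> simp at * <;> omega
  ext x
  have e : (zPerm μ)⁻¹ (zPerm μ x) = x := by simp
  rw [← hinv (zPerm μ x), e]

theorem g_f_of_antitone_init {q u : ℂ} (hq : q ≠ 0) (hu : u ≠ 0)
    (hqu : ∀ a b : ℕ, 1 ≤ a → b ≤ m → q ^ a * (u ^ 2) ^ b ≠ 1) {μ : Fin (m + 1) → ℤ}
    (h : Antitone fun j : Fin m => μ j.castSucc) :
    g q (f q u μ) = q ^ (-μ (Fin.last m)) • f q u (rot μ) := by
  have hz := isStableSort_zPerm_inv μ
  have hzt := zPerm_eq_tailCycle h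
  set k := (zPerm μ)⁻¹ (Fin.last m) with hk
  have hanti := antitone_decr μ
  have hval : ∀ a, decr μ ((zPerm μ)⁻¹ a) = μ a := by
    intro a
    have := act_apply_apply (zPerm μ) (decr μ) ((zPerm μ)⁻¹ a)
    rw [act_zPerm_decr] at this
    rw [← this]; simp
  have hdk : decr μ k = μ (Fin.last m) := hval _
  have hlast : ∀ j, k < j → decr μ j < decr μ k := by
    intro j hj
    have hj' : (zPerm μ)⁻¹ (zPerm μ j) = j := by simp
    rw [← hj', hk, hz] at hj
    rw [hdk, ← hj', hval]
    rcases hj with h1 | ⟨-, h1⟩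
    · simpa using h1
    · exact absurd h1 (Fin.le_last _).not_gt
  have hE := isMacdonaldE_macdonaldE hq hu hqu (decr μ)
  have hμ : act (tailCycle k) (decr μ) = μ := by rw [← hzt, act_zPerm_decr]
  have hrot : act (Fin.partialProd s k) (decr μ) = rot μ := by
    rw [← partialProd_s_mul_tailCycle, act_mul, hμ, act_partialProd_s_last]
  have h1 := tailProd_f q u k (decr μ) hlast
  have h2 := partialProd_T_f hq hu hqu k (decr μ) fun j hj => hanti hj.le
  rw [hμ, f_of_antitone q u hanti] at h1
  rw [hrot, f_of_antitone q u hanti] at h2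
  have h3 : g q (tailProd u k (macdonaldE q u (decr μ))) = eigenvalue q u (decr μ) k •
      Fin.partialProd (T u) k (macdonaldE q u (decr μ)) := by
    have hY := hE.1 k
    rw [← eigenvalue_eq, Y_eq hu] at hY
    have := congrArg (⇑(Fin.partialProd (T u) k)) hY
    rw [map_smul, ← Module.End.mul_apply, ← mul_assoc, ← mul_assoc,
      partialProd_T_mul_headInvProd hu, one_mul] at this
    exact this
  have h4 : Fin.partialProd (T u) k (macdonaldE q u (decr μ)) =
      ((u ^ (k : ℕ))⁻¹ * (u ^ 2) ^ equalsBefore (decr μ) k) • f q u (rot μ) := by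
    rw [mul_smul, ← h2, smul_smul, inv_mul_cancel₀ (pow_ne_zero _ hu), one_smul]
  rw [← h1, map_smul, h3, h4, smul_smul, smul_smul, eigenvalue, hdk,
    position_of_last_equal hanti hlast]
  congr 1
  have hkm : (k : ℕ) ≤ m := Nat.lt_succ_iff.mp k.isLt
  generalize equalsBefore (decr μ) k = c
  have hpow : u ^ (m - (k : ℕ)) * u ^ (-2 * ((m - (k : ℕ) + c : ℕ) : ℤ) + (m : ℤ)) *
      ((u ^ (k : ℕ))⁻¹ * (u ^ 2) ^ c) = 1 := by
    rw [← pow_mul, ← zpow_natCast u (m - k), ← zpow_natCast u (k : ℕ), ← zpow_natCast u (2 * c),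
      ← zpow_neg, ← zpow_add₀ hu, ← zpow_add₀ hu, ← zpow_add₀ hu]
    convert zpow_zero u using 2
    push_cast [hkm]
    ring
  linear_combination q ^ (-μ (Fin.last m)) * hpow

theorem g_f {q u : ℂ} (hq : q ≠ 0) (hu : u ≠ 0)
    (hqu : ∀ a b : ℕ, 1 ≤ a → b ≤ m → q ^ a * (u ^ 2) ^ b ≠ 1) (μ : Fin (m + 1) → ℤ) :
    g q (f q u μ) = q ^ (-μ (Fin.last m)) • f q u (rot μ) := by
  generalize hk : length (zPerm μ) = k
  induction k using Nat.strong_induction_on generalizing μ with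
  | _ k ih =>
  by_cases hex : ∃ i j : Fin m, j.castSucc = i.succ ∧ μ i.castSucc < μ i.succ
  · obtain ⟨i, j, hij, hlt⟩ := hex
    have hlt' : act (s i) μ i.succ < act (s i) μ i.castSucc := by
      rwa [act_s_apply_castSucc, act_s_apply_succ]
    have hf := smul_T_f_of_gt q u hlt'
    have hl := length_zPerm_act_s hlt'
    rw [act_s_act_s] at hf hl
    have hrot : rot (act (s i) μ) j.succ < rot (act (s i) μ) j.castSucc := by
      rwa [rot_succ, hij, rot_succ]
    have hgT := LinearMap.congr_fun (g_mul_T hq u hij) (f q u (act (s i) μ))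
    rw [Module.End.mul_apply, Module.End.mul_apply] at hgT
    rw [← hf, map_smul, hgT, ih _ (by omega) (act (s i) μ) rfl, map_smul, smul_comm,
      smul_T_f_of_gt q u hrot, rot_act_s hij, act_s_act_s, act_s_apply_last hij]
  · push Not at hex
    refine g_f_of_antitone_init hq hu hqu ?_
    obtain _ | m := m
    · intro a; exact a.elim0
    · exact Fin.antitone_iff_succ_le.mpr fun i => hex i.castSucc i.succ rfl

end KZ

end

theorem proposition1p2 (m : ℕ) (q u : ℂ) (hq : q ≠ 0) (hu : u ≠ 0)
    (hqu : ∀ a b : ℕ, 1 ≤ a → b ≤ m → q ^ a * (u ^ 2) ^ b ≠ 1) :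
    (∀ μ : Fin (m + 1) → ℤ, ∃! E : KZ.Laurent m, KZ.IsMacdonaldE q u μ E) ∧
    ∀ μ : Fin (m + 1) → ℤ,
      (∀ i : Fin m, μ i.succ < μ i.castSucc →
        u • KZ.T u i (KZ.f q u μ) = KZ.f q u (KZ.act (KZ.s i) μ)) ∧
      (∀ i : Fin m, μ i.castSucc = μ i.succ →
        u • KZ.T u i (KZ.f q u μ) = u ^ 2 • KZ.f q u μ) ∧
      KZ.g q (KZ.f q u μ) = q ^ (-μ (Fin.last m)) • KZ.f q u (KZ.rot μ) := by
  refine ⟨fun μ => ?_, fun μ => ⟨fun i h => KZ.smul_T_f_of_gt q u h, fun i h => ?_,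
    KZ.g_f hq hu hqu μ⟩⟩
  · obtain ⟨E, hE⟩ := KZ.exists_isMacdonaldE hq hu hqu μ
    exact ⟨E, hE, fun E' hE' => hE'.unique hq hu hqu hE⟩
  · rw [KZ.T_f_of_eq hq hu hqu h, smul_smul, pow_two]
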